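/- Let $(D,\mathcal{D},\varrho)$ be a probability space and let $\mu$ be a probability measure on $D$ that is absolutely continuous with respect to $\varrho$. Put $v = \mathrm{d}\mu/\mathrm{d}\varrho$ and $w = 1/v : D \to [0,\infty]$. Let $\mathcal{P} \subset L^2_\varrho(D)$ be an $n$-dimensional complex subspace containing the constant function $1$ (its elements being evaluated pointwise through a fixed linear choice of representatives). For a $\varrho$-measurable set $\Omega \subseteq D$ write $L^q_\varrho(\Omega)$ for the Lebesgue space of the restricted measure $\varrho|_\Omega$, and define $$\mathcal{K}_\Omega(x) = \sup\{ |p(x)|^2 : p \in \mathcal{P},\ \|p\|^2_{L^2_\varrho(\Omega)} = 1 \},$$ $$\kappa_w = \operatorname*{ess\,sup}_{x \sim \varrho|_\Omega} w(x)\,\mathcal{K}_\Omega(x), \qquad \kappa = \operatorname*{ess\,sup}_{x \sim \varrho|_\Omega} \mathcal{K}_\Omega(x),$$ with values in $[0,\infty]$. Suppose that $v > 0$ $\varrho$-almost everywhere on $\Omega$. Let $f \in L^2_\varrho(D)$, let $f_n \in \mathcal{P}$ be its best $L^2_\varrho(D)$-norm approximation from $\mathcal{P}$, let $0 < \epsilon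 < 1$, and let $$m \ge 8\, \kappa_w \log(3n/\epsilon).$$ Let $x_1,\dots,x_m$ be independent random points with law $\mu$. Then the following holds with probability at least $1-\epsilon$. For every $e \in \mathbb{C}^m$ and every minimizer $\hat f$ of the weighted least-squares problem $$\min_{p \in \mathcal{P}} \frac1m \sum_{i=1}^m w(x_i)\, |f(x_i) + e_i - p(x_i)|^2,$$ one has $$\|f - \hat f\|_{L^2_\varrho(\Omega)} \le \frac{9}{\sqrt\epsilon} \|f - f_n\|_{L^2_\varrho(D)} + \frac{8}{\sqrt\epsilon} \|e\|_2,$$ $$\|f - \hat f\|_{L^\infty_\varrho(\Omega)} \le \|f - f_n\|_{L^\infty_\varrho(\Omega)} + 8\sqrt{\frac{\kappa}{\epsilon}}\, \|f - f_n\|_{L^2_\varrho(D)} + 8\sqrt{\frac{\kappa}{\epsilon}}\, \|e\|_2,$$ where the inequalities are read in $[0,\infty]$ with $0\cdot\infty = 0$. -/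

import Mathlib

open MeasureTheory ProbabilityTheory
open scoped ENNReal

/-- The (reciprocal) Christoffel function of a space `P` of functions, relative to `L²(ν)`:
`K(x) = sup {|p(x)|² : p ∈ P, ‖p‖²_{L²(ν)} = 1}`, with values in `[0, ∞]`. -/
noncomputable def christoffelFn {D : Type*} [MeasurableSpace D]
    (P : Submodule ℂ (D → ℂ)) (ν : Measure D) (x : D) : ℝ≥0∞ :=
  sSup {t | ∃ p ∈ P, eLpNorm p 2 ν ^ 2 = 1 ∧ t = ‖p x‖ₑ ^ 2}

/-- `κ_w(P, L²(ν)) = ess sup_{x ∼ ν} w(x) K(P, L²(ν))(x)`. -/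
noncomputable def christoffelKappa {D : Type*} [MeasurableSpace D]
    (P : Submodule ℂ (D → ℂ)) (ν : Measure D) (w : D → ℝ≥0∞) : ℝ≥0∞ :=
  essSup (fun x => w x * christoffelFn P ν x) ν

/-- The weight `w = 1 / (dμ/dϱ) : D → [0, ∞]`. -/
noncomputable def samplingWeight {D : Type*} [MeasurableSpace D]
    (μ ϱ : Measure D) (x : D) : ℝ≥0∞ :=
  1 / μ.rnDeriv ϱ x

/-- The weighted least-squares objective `(1/m) ∑ᵢ w(xᵢ) |yᵢ - p(xᵢ)|²`. -/
noncomputable def wlsObjective {D : Type*} {m : ℕ} (w : D → ℝ≥0∞) (x : Fin m → D)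
    (y : Fin m → ℂ) (p : D → ℂ) : ℝ≥0∞ :=
  1 / (m : ℝ≥0∞) * ∑ i, w (x i) * ‖y i - p (x i)‖ₑ ^ 2

/-- `p` solves the weighted least-squares problem over `P`. -/
def IsWLSMinimizer {D : Type*} {m : ℕ} (P : Submodule ℂ (D → ℂ)) (w : D → ℝ≥0∞)
    (x : Fin m → D) (y : Fin m → ℂ) (p : D → ℂ) : Prop :=
  p ∈ P ∧ ∀ q ∈ P, wlsObjective w x y p ≤ wlsObjective w x y q

/-- `g` is a best `L²(ϱ)`-norm approximation to `f` from `P`. -/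
def IsBestL2Approx {D : Type*} [MeasurableSpace D] (P : Submodule ℂ (D → ℂ)) (ϱ : Measure D)
    (f g : D → ℂ) : Prop :=
  g ∈ P ∧ ∀ q ∈ P, eLpNorm (f - g) 2 ϱ ≤ eLpNorm (f - q) 2 ϱ

/-! The error bounds follow deterministically, for all `e` and `fhat` at once, from three events
that each fail with probability at most ε/3.

The first is the lower frame bound `m ‖p‖² ≤ 2 ∑ w(xᵢ) |p(xᵢ)|²` on `P`, with the norm of `L²(Ω)`.
For an orthonormal family φ spanning `P` in `L²(Ω)`, the vectors `uᵢ = 1_Ω(xᵢ) √w(xᵢ) φ(xᵢ)` are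
independent, with `E uᵢuᵢ* = 1` and `|uᵢ|² ≤ κ_w` almost surely. A matrix Chernoff bound
(`measureReal_not_posSemidef_gram_le`) gives `∑ uᵢuᵢ* ≥ m/2` outside probability `n exp(-m/(8κ_w)) ≤
ε/3`. It rests on Golden–Thompson, deduced from the Lie–Trotter formula and a trace inequality for
exponents `2^j`.

The other two are Markov bounds: since `∫ w h dμ ≤ ∫ h dϱ`, the sums `∑ w |f - fn|²` and `∑ w` have
means at most `m ‖f - fn‖²` and `m`.

Comparing the objective at `fhat` and `fn` then controls `‖fhat - fn‖` in `L²(Ω)`. The triangle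
inequality gives the `L²` estimate, and `‖p‖_∞ ≤ √κ ‖p‖₂` on `P` gives the `L^∞` one. -/

/-! ### The Lie–Trotter formula in a Banach algebra. -/

open NormedSpace in
theorem norm_normedSpace_exp_le {𝔸 : Type*} [NormedRing 𝔸] [NormOneClass 𝔸] [NormedAlgebra ℝ 𝔸]
    [CompleteSpace 𝔸] (x : 𝔸) : ‖exp x‖ ≤ Real.exp ‖x‖ := by
  rw [Real.exp_eq_exp_ℝ, exp_eq_tsum ℝ, exp_eq_tsum ℝ]
  have hs : Summable fun n : ℕ => ((n.factorial : ℝ)⁻¹) • ‖x‖ ^ n := expSeries_summable' ‖x‖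
  refine tsum_of_norm_bounded hs.hasSum fun n => ?_
  rw [norm_smul, norm_inv, Real.norm_natCast, smul_eq_mul]
  gcongr
  exact norm_pow_le x n

/-- Telescoping. In Lie–Trotter `c` is `exp((‖a‖ + ‖b‖)/(n+1))`, so `c ^ n` stays bounded and only
`(n+1) ‖x - y‖` has to vanish. -/
theorem norm_pow_sub_pow_le_mul {𝔸 : Type*} [NormedRing 𝔸] [NormOneClass 𝔸] {x y : 𝔸} {c : ℝ}
    (hx : ‖x‖ ≤ c) (hy : ‖y‖ ≤ c) (n : ℕ) :
    ‖x ^ (n + 1) - y ^ (n + 1)‖ ≤ (n + 1) * c ^ n * ‖x - y‖ := by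
  have hc : 0 ≤ c := (norm_nonneg x).trans hx
  induction n with
  | zero => simp
  | succ n ih =>
    have h : x ^ (n + 1 + 1) - y ^ (n + 1 + 1)
        = x ^ (n + 1) * (x - y) + (x ^ (n + 1) - y ^ (n + 1)) * y := by
      rw [pow_succ x (n + 1), pow_succ y (n + 1)]; noncomm_ring
    rw [h]
    calc _ ≤ ‖x ^ (n + 1)‖ * ‖x - y‖ + ‖x ^ (n + 1) - y ^ (n + 1)‖ * ‖y‖ :=
          (norm_add_le _ _).trans (add_le_add (norm_mul_le _ _) (norm_mul_le _ _))
      _ ≤ c ^ (n + 1) * ‖x - y‖ + ((n + 1) * c ^ n * ‖x - y‖) * c := by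
          gcongr
          exact (norm_pow_le x _).trans (pow_le_pow_left₀ (norm_nonneg x) hx _)
      _ = _ := by push_cast; ring

open NormedSpace Filter Topology in
/-- The Lie–Trotter product formula. -/
theorem tendsto_exp_mul_exp_pow {𝔸 : Type*} [NormedRing 𝔸] [NormOneClass 𝔸] [NormedAlgebra ℝ 𝔸]
    [CompleteSpace 𝔸] (a b : 𝔸) :
    Tendsto (fun n : ℕ => (exp (((n : ℝ) + 1)⁻¹ • a) * exp (((n : ℝ) + 1)⁻¹ • b)) ^ (n + 1))
      atTop (𝓝 (exp (a + b))) := by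
  have key : Tendsto (fun n : ℕ => ((n : ℝ) + 1) *
      ‖exp (((n : ℝ) + 1)⁻¹ • a) * exp (((n : ℝ) + 1)⁻¹ • b) - exp (((n : ℝ) + 1)⁻¹ • (a + b))‖)
      atTop (𝓝 0) := by
    -- Both curves start at 1 with velocity `a + b`, so the difference has slope tending to zero; at
    -- `t = 1/(n+1)` the norm of that slope is the quantity in `key`.
    have hd : HasDerivAt (fun t : ℝ => exp (t • a) * exp (t • b) - exp (t • (a + b))) 0 0 := by
      have h := ((hasDerivAt_exp_smul_const a (0 : ℝ)).mul (hasDerivAt_exp_smul_const b (0 : ℝ))).sub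
        (hasDerivAt_exp_smul_const (a + b) (0 : ℝ))
      exact h.congr_deriv (by simp)
    have ht : Tendsto (fun n : ℕ => ((n : ℝ) + 1)⁻¹) atTop (𝓝[≠] 0) := by
      refine tendsto_nhdsWithin_iff.2 ⟨?_, Eventually.of_forall fun n => ?_⟩
      · simpa [one_div] using tendsto_one_div_add_atTop_nhds_zero_nat (𝕜 := ℝ)
      · have : (0 : ℝ) < n + 1 := by positivity
        simpa using this.ne'
    have h2 := (hd.tendsto_slope.comp ht).norm
    simp only [norm_zero] at h2
    refine h2.congr fun n => ?_
    have : (0 : ℝ) < n + 1 := by positivity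
    simp [slope, norm_smul, abs_of_pos this]
  rw [tendsto_iff_norm_sub_tendsto_zero]
  refine squeeze_zero (fun _ => norm_nonneg _) (fun n => ?_)
    (by simpa using key.const_mul (Real.exp (‖a‖ + ‖b‖)))
  have hn : (0 : ℝ) < n + 1 := by positivity
  have hsm : ∀ c : 𝔸, ‖exp (((n : ℝ) + 1)⁻¹ • c)‖ ≤ Real.exp (((n : ℝ) + 1)⁻¹ * ‖c‖) := fun c => by
    simpa [norm_smul, abs_of_pos hn] using norm_normedSpace_exp_le (((n : ℝ) + 1)⁻¹ • c)
  have hx : ‖exp (((n : ℝ) + 1)⁻¹ • a) * exp (((n : ℝ) + 1)⁻¹ • b)‖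
      ≤ Real.exp (((n : ℝ) + 1)⁻¹ * (‖a‖ + ‖b‖)) := by
    rw [mul_add, Real.exp_add]
    exact (norm_mul_le _ _).trans (mul_le_mul (hsm a) (hsm b) (norm_nonneg _) (Real.exp_nonneg _))
  have hy : ‖exp (((n : ℝ) + 1)⁻¹ • (a + b))‖ ≤ Real.exp (((n : ℝ) + 1)⁻¹ * (‖a‖ + ‖b‖)) :=
    (hsm _).trans (Real.exp_le_exp.2 (by gcongr; exact norm_add_le a b))
  have hpow : exp (a + b) = exp (((n : ℝ) + 1)⁻¹ • (a + b)) ^ (n + 1) := by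
    let _ : NormedAlgebra ℚ 𝔸 := NormedAlgebra.restrictScalars ℚ ℝ 𝔸
    rw [← exp_nsmul, ← Nat.cast_smul_eq_nsmul ℝ, smul_smul]
    push_cast
    rw [mul_inv_cancel₀ hn.ne', one_smul]
  rw [hpow]
  refine (norm_pow_sub_pow_le_mul hx hy n).trans ?_
  rw [← Real.exp_nat_mul, mul_comm ((n : ℝ) + 1) (Real.exp _), mul_assoc]
  rw [← smul_add]
  refine mul_le_mul_of_nonneg_right (Real.exp_le_exp.2 ?_) (by positivity)
  rw [← mul_assoc]
  refine mul_le_of_le_one_left (by positivity) ?_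
  rw [← div_eq_mul_inv, div_le_one hn]
  linarith

/-! ### Trace inequalities and Golden–Thompson. -/

namespace Matrix

theorem re_trace_mul_le {ι : Type*} [Fintype ι] (A B : Matrix ι ι ℂ) :
    (A * B).trace.re ≤ ((A * Aᴴ).trace.re + (B * Bᴴ).trace.re) / 2 := by
  have hre : ∀ M : Matrix ι ι ℂ, (M * Mᴴ).trace.re = ∑ i, ∑ j, ‖M i j‖ ^ 2 := fun M => by
    simp only [trace, diag, mul_apply, conjTranspose_apply, Complex.re_sum]
    refine Finset.sum_congr rfl fun i _ => Finset.sum_congr rfl fun j _ => ?_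
    rw [← starRingEnd_apply, Complex.mul_conj, Complex.ofReal_re, Complex.normSq_eq_norm_sq]
  rw [hre, hre, Finset.sum_comm (f := fun i j => ‖B i j‖ ^ 2)]
  simp only [trace, diag, mul_apply, Complex.re_sum]
  rw [← Finset.sum_add_distrib, Finset.sum_div]
  refine Finset.sum_le_sum fun i _ => ?_
  rw [← Finset.sum_add_distrib, Finset.sum_div]
  refine Finset.sum_le_sum fun j _ => ?_
  have := (Complex.re_le_norm (A i j * B j i))
  rw [norm_mul] at this
  nlinarith [sq_nonneg (‖A i j‖ - ‖B j i‖)]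

variable {ι : Type*} [Fintype ι] [DecidableEq ι]

theorem trace_mul_pow_comm {R : Type*} [CommSemiring R] (A B : Matrix ι ι R) (k : ℕ) :
    ((A * B) ^ k).trace = ((B * A) ^ k).trace := by
  cases k with
  | zero => simp
  | succ k =>
    have h : ∀ k : ℕ, A * (B * A) ^ k = (A * B) ^ k * A := fun k => by
      induction k with
      | zero => simp
      | succ k ih => rw [pow_succ, ← mul_assoc, ih, pow_succ]; simp only [mul_assoc]
    rw [pow_succ, ← mul_assoc, ← h, mul_assoc, trace_mul_comm, mul_assoc, ← pow_succ]

/-- The two statements are proved jointly since each feeds the other. The first at `j + 1` applies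
the first at `j` to `X²`, cycles the trace, then uses the second on `XᴴX` and `XXᴴ` with
`re_trace_mul_le`. The second applies the first to `AB`, cycles `AB²A` into `A²B²`, and recurses on
the squares. -/
theorem re_trace_pow_two_pow_le_and (j : ℕ) :
    (∀ X : Matrix ι ι ℂ, (X ^ 2 ^ (j + 1)).trace.re ≤ ((X * Xᴴ) ^ 2 ^ j).trace.re) ∧
    (∀ A B : Matrix ι ι ℂ, A.IsHermitian → B.IsHermitian →
      ((A * B) ^ 2 ^ j).trace.re ≤ (A ^ 2 ^ j * B ^ 2 ^ j).trace.re) := by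
  induction j with
  | zero =>
    refine ⟨fun X => ?_, fun A B _ _ => by simp⟩
    simpa [pow_two] using re_trace_mul_le X X
  | succ j ih =>
    obtain ⟨hT, hQ⟩ := ih
    constructor
    · intro X
      have h1 : (X ^ 2 ^ (j + 1 + 1)).trace.re ≤ (((Xᴴ * X) * (X * Xᴴ)) ^ 2 ^ j).trace.re := by
        have h := hT (X ^ 2)
        rw [← pow_mul, ← pow_succ'] at h
        have e : X ^ 2 * (X ^ 2)ᴴ = (X * X * Xᴴ) * Xᴴ := by
          rw [pow_two, conjTranspose_mul]; simp only [mul_assoc]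
        rw [e, trace_mul_pow_comm] at h
        simpa only [mul_assoc] using h
      refine h1.trans ((hQ _ _ (isHermitian_conjTranspose_mul_self X)
        (isHermitian_mul_conjTranspose_self X)).trans ((re_trace_mul_le _ _).trans ?_))
      rw [((isHermitian_conjTranspose_mul_self X).pow _).eq,
        ((isHermitian_mul_conjTranspose_self X).pow _).eq, ← pow_add, ← pow_add,
        trace_mul_pow_comm Xᴴ X, add_self_div_two, ← two_mul, ← pow_succ']
    · intro A B hA hB
      have h := hT (A * B)
      have e : A * B * (A * B)ᴴ = (A * B ^ 2) * A := by
        rw [conjTranspose_mul, hA.eq, hB.eq, pow_two]; simp only [mul_assoc]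
      rw [e, trace_mul_pow_comm (A * B ^ 2) A, ← mul_assoc, ← pow_two] at h
      refine h.trans ((hQ _ _ (hA.pow 2) (hB.pow 2)).trans ?_)
      rw [← pow_mul, ← pow_mul, ← pow_succ']

open NormedSpace Filter Topology in
/-- The Golden–Thompson inequality. -/
theorem re_trace_exp_add_le [Nonempty ι] {A B : Matrix ι ι ℂ} (hA : A.IsHermitian)
    (hB : B.IsHermitian) : (exp (A + B)).trace.re ≤ (exp A * exp B).trace.re := by
  let : NormedRing (Matrix ι ι ℂ) := Matrix.linftyOpNormedRing
  let : NormedAlgebra ℝ (Matrix ι ι ℂ) := Matrix.linftyOpNormedAlgebra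
  have : NormOneClass (Matrix ι ι ℂ) := Matrix.linfty_opNormOneClass
  have hlim := tendsto_exp_mul_exp_pow A B
  -- Lie–Trotter has exponent `n + 1` while the trace inequality covers `2 ^ k`, hence the
  -- subsequence `n = 2 ^ k - 1`.
  have hsub : Tendsto (fun k : ℕ => 2 ^ k - 1) atTop atTop :=
    (tendsto_sub_atTop_nat 1).comp (tendsto_pow_atTop_atTop_of_one_lt one_lt_two)
  have hc : Continuous fun M : Matrix ι ι ℂ => M.trace.re :=
    Complex.continuous_re.comp (continuous_id.matrix_trace)
  refine le_of_tendsto ((hc.tendsto _).comp (hlim.comp hsub)) (Eventually.of_forall fun k => ?_)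
  have h1 : 2 ^ k - 1 + 1 = 2 ^ k := Nat.sub_add_cancel Nat.one_le_two_pow
  have h2 : ((2 ^ k - 1 : ℕ) : ℝ) + 1 = ((2 ^ k : ℕ) : ℝ) := by exact_mod_cast congrArg Nat.cast h1
  simp only [Function.comp_apply]
  rw [h1, h2]
  have hp : ∀ M : Matrix ι ι ℂ, exp ((((2 ^ k : ℕ) : ℝ))⁻¹ • M) ^ 2 ^ k = exp M := fun M => by
    rw [← Matrix.exp_nsmul, ← Nat.cast_smul_eq_nsmul ℝ, smul_smul,
      mul_inv_cancel₀ (by positivity), one_smul]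
  have hh : ∀ {M : Matrix ι ι ℂ}, M.IsHermitian →
      (exp ((((2 ^ k : ℕ) : ℝ))⁻¹ • M)).IsHermitian := fun {M} hM => by
    refine IsHermitian.exp ?_
    rw [IsHermitian, conjTranspose_smul, hM.eq, star_trivial]
  refine ((re_trace_pow_two_pow_le_and k).2 _ _ (hh hA) (hh hB)).trans ?_
  rw [hp, hp]

end Matrix

/-! ### Exponentials of Hermitian matrices. -/

open scoped ComplexOrder

namespace Matrix

section

variable {ι : Type*} [Fintype ι] [DecidableEq ι]

theorem IsHermitian.exp_smul_eq {A : Matrix ι ι ℂ} (hA : A.IsHermitian) (t : ℝ) :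
    NormedSpace.exp (t • A) = (hA.eigenvectorUnitary : Matrix ι ι ℂ) *
      diagonal (fun i => (Real.exp (t * hA.eigenvalues i) : ℂ)) *
      star (hA.eigenvectorUnitary : Matrix ι ι ℂ) := by
  have hU : IsUnit (hA.eigenvectorUnitary : Matrix ι ι ℂ) :=
    (Unitary.toUnits hA.eigenvectorUnitary).isUnit
  have hinv : (hA.eigenvectorUnitary : Matrix ι ι ℂ)⁻¹
      = star (hA.eigenvectorUnitary : Matrix ι ι ℂ) :=
    inv_eq_left_inv (Unitary.coe_star_mul_self _)
  have h1 : t • A = (hA.eigenvectorUnitary : Matrix ι ι ℂ) *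
      diagonal (fun i => ((t * hA.eigenvalues i : ℝ) : ℂ)) *
      (hA.eigenvectorUnitary : Matrix ι ι ℂ)⁻¹ := by
    conv_lhs => rw [hA.spectral_theorem, Unitary.conjStarAlgAut_apply]
    rw [hinv, ← smul_mul_assoc, ← mul_smul_comm, ← diagonal_smul]
    congr 3
    ext i
    simp
  rw [h1, Matrix.exp_conj _ _ hU, hinv, Matrix.exp_diagonal]
  congr 3
  ext i
  rw [Pi.coe_exp, ← Complex.exp_eq_exp_ℂ, Complex.ofReal_exp]

theorem IsHermitian.re_trace_exp_smul {A : Matrix ι ι ℂ} (hA : A.IsHermitian) (t : ℝ) :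
    (NormedSpace.exp (t • A)).trace.re = ∑ i, Real.exp (t * hA.eigenvalues i) := by
  rw [hA.exp_smul_eq, trace_mul_comm, ← mul_assoc, Unitary.coe_star_mul_self, one_mul,
    trace_diagonal, ← Complex.ofReal_sum, Complex.ofReal_re]

theorem IsHermitian.posSemidef_exp {A : Matrix ι ι ℂ} (hA : A.IsHermitian) :
    (NormedSpace.exp A).PosSemidef := by
  have h := hA.exp_smul_eq 1
  rw [one_smul] at h
  rw [h]
  refine PosSemidef.mul_mul_conjTranspose_same (posSemidef_diagonal_iff.2 fun i => ?_) _
  exact_mod_cast (Real.exp_pos _).le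

/-- The Laplace-transform step of the Chernoff method: one negative eigenvalue alone contributes at
least 1, and all other terms are positive. -/
theorem IsHermitian.one_le_re_trace_exp {A : Matrix ι ι ℂ} (hA : A.IsHermitian)
    (hn : ¬ A.PosSemidef) {t : ℝ} (ht : t ≤ 0) : 1 ≤ (NormedSpace.exp (t • A)).trace.re := by
  rw [hA.posSemidef_iff_eigenvalues_nonneg, Pi.le_def] at hn
  push Not at hn
  obtain ⟨i, hi⟩ := hn
  rw [hA.re_trace_exp_smul]
  calc (1 : ℝ) ≤ Real.exp (t * hA.eigenvalues i) :=
        Real.one_le_exp (mul_nonneg_of_nonpos_of_nonpos ht hi.le)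
    _ ≤ _ := Finset.single_le_sum (f := fun i => Real.exp (t * hA.eigenvalues i))
        (fun _ _ => (Real.exp_pos _).le) (Finset.mem_univ i)

/-- The chord of the convex exponential between `0` and `-log 2`, where its values are 1 and 1/2. -/
theorem _root_.Real.exp_neg_log_two_mul_le {y : ℝ} (h0 : 0 ≤ y) (h1 : y ≤ 1) :
    Real.exp (-(Real.log 2 * y)) ≤ 1 - y / 2 := by
  have h := convexOn_exp.2 (Set.mem_univ 0) (Set.mem_univ (-Real.log 2)) (sub_nonneg.2 h1) h0
    (by ring)
  simp only [smul_eq_mul, Real.exp_zero, Real.exp_neg, Real.exp_log two_pos, mul_zero,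
    zero_add] at h
  rw [mul_comm, neg_mul_eq_mul_neg]
  refine h.trans_eq ?_
  ring

/-- In an eigenbasis of `Z` the matrix `M` has nonnegative diagonal, so the scalar chord bound
applies to each `λᵢ/κ`. The trace hypothesis serves to place these in `[0, 1]`. -/
theorem PosSemidef.re_trace_mul_exp_le {M Z : Matrix ι ι ℂ} (hM : M.PosSemidef)
    (hZ : Z.PosSemidef) {κ : ℝ} (hκ : 0 < κ) (htr : Z.trace.re ≤ κ) :
    (M * NormedSpace.exp (-(Real.log 2 / κ) • Z)).trace.re ≤ M.trace.re - (M * Z).trace.re / (2 * κ) := by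
  have hH := hZ.isHermitian
  set U := (hH.eigenvectorUnitary : Matrix ι ι ℂ) with hU
  have hUU : U * star U = 1 := Unitary.coe_mul_star_self _
  have htrace : ∀ d : ι → ℝ, (M * (U * diagonal (fun i => (d i : ℂ)) * star U)).trace.re
      = ∑ i, ((star U * M * U) i i).re * d i := fun d => by
    rw [← mul_assoc, trace_mul_comm, ← mul_assoc, ← mul_assoc, trace]
    simp [mul_diagonal]
  have hpos : ∀ i, 0 ≤ ((star U * M * U) i i).re := fun i => by
    have h := (hM.conjTranspose_mul_mul_same U).diag_nonneg (i := i)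
    exact (Complex.le_def.1 h).1
  have hZe : Z = U * diagonal (fun i => (hH.eigenvalues i : ℂ)) * star U := by
    conv_lhs => rw [hH.spectral_theorem, Unitary.conjStarAlgAut_apply]
    rfl
  have h1 : M.trace.re = ∑ i, ((star U * M * U) i i).re := by
    have := htrace 1
    simpa [hUU] using this
  have hlam : ∀ i, hH.eigenvalues i ≤ κ := fun i => by
    refine le_trans ?_ htr
    rw [hH.trace_eq_sum_eigenvalues]
    simp only [Complex.re_sum, Complex.coe_algebraMap, Complex.ofReal_re]
    exact Finset.single_le_sum (f := hH.eigenvalues)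
      (fun i _ => hZ.eigenvalues_nonneg i) (Finset.mem_univ i)
  have h2 : (M * Z).trace.re = ∑ i, ((star U * M * U) i i).re * hH.eigenvalues i := by
    conv_lhs => rw [hZe]
    exact htrace _
  rw [hH.exp_smul_eq, ← hU, htrace, h1, h2, Finset.sum_div, ← Finset.sum_sub_distrib]
  refine Finset.sum_le_sum fun i _ => ?_
  have h3 := Real.exp_neg_log_two_mul_le (y := hH.eigenvalues i / κ)
    (div_nonneg (hZ.eigenvalues_nonneg i) hκ.le) ((div_le_one hκ).2 (hlam i))
  calc _ ≤ ((star U * M * U) i i).re * (1 - hH.eigenvalues i / κ / 2) := by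
        refine mul_le_mul_of_nonneg_left (le_of_eq_of_le ?_ h3) (hpos i)
        congr 1; ring
    _ = _ := by field_simp

theorem continuous_exp : Continuous (NormedSpace.exp : Matrix ι ι ℂ → Matrix ι ι ℂ) := by
  let _ : NormedRing (Matrix ι ι ℂ) := Matrix.linftyOpNormedRing
  let _ : NormedAlgebra ℝ (Matrix ι ι ℂ) := Matrix.linftyOpNormedAlgebra
  let _ : NormedAlgebra ℚ (Matrix ι ι ℂ) := NormedAlgebra.restrictScalars ℚ ℝ _
  exact NormedSpace.exp_continuous

end

end Matrix

/-! ### Matrix Chernoff bound for rank-one summands. -/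

section

open Matrix

variable {S ι : Type*} [MeasurableSpace S] [Fintype ι]

theorem isHermitian_sum_vecMulVec {T : Type*} [Fintype T] (u : T → ι → ℂ) :
    (∑ i, vecMulVec (u i) (star (u i))).IsHermitian :=
  (posSemidef_sum _ fun i _ => posSemidef_vecMulVec_self_star (u i)).isHermitian

theorem isHermitian_smul_sum_vecMulVec {T : Type*} [Fintype T] (θ : ℝ) (u : T → ι → ℂ) :
    (θ • ∑ i, vecMulVec (u i) (star (u i))).IsHermitian := by
  rw [IsHermitian, conjTranspose_smul, (isHermitian_sum_vecMulVec u).eq, star_trivial]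

theorem re_trace_vecMulVec_star (v : ι → ℂ) :
    (vecMulVec v (star v)).trace.re = ∑ j, ‖v j‖ ^ 2 := by
  simp only [trace, diag, vecMulVec_apply, Pi.star_apply, Complex.re_sum]
  refine Finset.sum_congr rfl fun j _ => ?_
  rw [← starRingEnd_apply, Complex.mul_conj, Complex.ofReal_re, Complex.normSq_eq_norm_sq]

variable [DecidableEq ι]

/-- The matrix `exp (-θ ∑ᵢ uᵢ uᵢ*)`. -/
noncomputable def expNegGram {T : Type*} [Fintype T] (θ : ℝ) (u : T → ι → ℂ) : Matrix ι ι ℂ :=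
  NormedSpace.exp (-θ • ∑ i, vecMulVec (u i) (star (u i)))

theorem continuous_expNegGram {T : Type*} [Fintype T] (θ : ℝ) :
    Continuous (expNegGram θ : (T → ι → ℂ) → Matrix ι ι ℂ) := by
  refine Matrix.continuous_exp.comp (Continuous.const_smul
    (continuous_finsetSum _ fun i _ => ?_) (-θ))
  exact (continuous_apply i).matrix_vecMulVec (continuous_apply i).star

theorem posSemidef_expNegGram {T : Type*} [Fintype T] (θ : ℝ) (u : T → ι → ℂ) :
    (expNegGram θ u).PosSemidef :=
  (isHermitian_smul_sum_vecMulVec _ u).posSemidef_exp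

theorem re_trace_expNegGram_nonneg {T : Type*} [Fintype T] (θ : ℝ) (u : T → ι → ℂ) :
    0 ≤ (expNegGram θ u).trace.re :=
  (Complex.le_def.1 (posSemidef_expNegGram θ u).trace_nonneg).1

/-- Golden–Thompson splits off the factor of the new summand, and the chord bound makes it linear,
ready for taking expectations. -/
theorem re_trace_expNegGram_insert_le [Nonempty ι] {T : Type*} [DecidableEq T] (u : T → ι → ℂ)
    {s : Finset T} {a : T} (ha : a ∉ s) {κ : ℝ} (hκ : 0 < κ) (hu : ∑ j, ‖u a j‖ ^ 2 ≤ κ) :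
    (expNegGram (Real.log 2 / κ) fun i : (insert a s : Finset T) => u i).trace.re
      ≤ (expNegGram (Real.log 2 / κ) fun i : s => u i).trace.re -
        (expNegGram (Real.log 2 / κ) (fun i : s => u i) *
          vecMulVec (u a) (star (u a))).trace.re / (2 * κ) := by
  have hsum : ∀ s : Finset T, ∑ i : s, vecMulVec (u i) (star (u i))
      = ∑ i ∈ s, vecMulVec (u i) (star (u i)) := fun s =>
    Finset.sum_coe_sort s fun i => vecMulVec (u i) (star (u i))
  have hZ := posSemidef_vecMulVec_self_star (u a)
  refine le_trans ?_ ((posSemidef_expNegGram _ _).re_trace_mul_exp_le hZ hκ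
    ((re_trace_vecMulVec_star (u a)).trans_le hu))
  unfold expNegGram
  rw [hsum (insert a s), Finset.sum_insert ha, smul_add, add_comm, ← hsum s]
  refine re_trace_exp_add_le (isHermitian_smul_sum_vecMulVec _ _) ?_
  rw [IsHermitian, conjTranspose_smul, hZ.isHermitian.eq, star_trivial]

variable {Pr : Measure S} [IsProbabilityMeasure Pr]

/-- Expected trace exponential of a sum of independent isotropic rank-one matrices. -/
theorem integral_re_trace_expNegGram_le [Nonempty ι] {T : Type*} [DecidableEq T]
    {u : T → S → ι → ℂ} (hum : ∀ i, Measurable (u i)) (hind : iIndepFun u Pr) {κ : ℝ} (hκ : 0 < κ)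
    (hu : ∀ i ω, ∑ j, ‖u i ω j‖ ^ 2 ≤ κ)
    (hiso : ∀ i j k, ∫ ω, u i ω j * star (u i ω k) ∂Pr = if j = k then 1 else 0) (s : Finset T) :
    Integrable (fun ω => (expNegGram (Real.log 2 / κ) fun i : s => u i ω).trace.re) Pr ∧
    ∫ ω, (expNegGram (Real.log 2 / κ) fun i : s => u i ω).trace.re ∂Pr
      ≤ Fintype.card ι * Real.exp (-(s.card / (2 * κ))) := by
  set θ := Real.log 2 / κ
  have hnorm : ∀ i ω, ‖u i ω‖ ≤ √κ := fun i ω => by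
    refine (pi_norm_le_iff_of_nonneg (Real.sqrt_nonneg κ)).2 fun j => Real.le_sqrt_of_sq_le ?_
    exact (Finset.single_le_sum (f := fun j => ‖u i ω j‖ ^ 2) (fun _ _ => by positivity)
      (Finset.mem_univ j)).trans (hu i ω)
  -- The vectors stay in a compact ball, so every continuous function of them is bounded and hence
  -- integrable.
  have hint : ∀ (s : Finset T) (g : (s → ι → ℂ) → ℂ), Continuous g →
      Integrable (fun ω => g fun i : s => u i ω) Pr := fun s g hg => by
    obtain ⟨C, hC⟩ := (isCompact_closedBall (0 : s → ι → ℂ) √κ).exists_bound_of_continuousOn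
      hg.continuousOn
    refine Integrable.of_bound ((hg.measurable.comp
      (measurable_pi_lambda _ fun i => hum i)).aestronglyMeasurable) C
      (Filter.Eventually.of_forall fun ω => hC _ ?_)
    rw [mem_closedBall_zero_iff, pi_norm_le_iff_of_nonneg (Real.sqrt_nonneg κ)]
    exact fun i => hnorm i ω
  have hent : ∀ (s : Finset T) (j k : ι), Continuous fun v : s → ι → ℂ => expNegGram θ v j k :=
    fun s j k => (continuous_expNegGram θ).matrix_elem j k
  have htr : ∀ s : Finset T,
      Integrable (fun ω => (expNegGram θ fun i : s => u i ω).trace.re) Pr := fun s =>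
    (hint s (fun v => (expNegGram θ v).trace) (continuous_expNegGram θ).matrix_trace).re
  refine ⟨htr s, ?_⟩
  induction s using Finset.induction_on with
  | empty => simp [expNegGram]
  | insert a s ha ih =>
    have hindep : ∀ j k, IndepFun (fun ω => expNegGram θ (fun i : s => u i ω) j k)
        (fun ω => u a ω k * star (u a ω j)) Pr := fun j k => by
      have h := hind.indepFun_finset s {a} (Finset.disjoint_singleton_right.2 ha) hum
      refine h.comp (φ := fun v => expNegGram θ v j k)
        (ψ := fun v : ({a} : Finset T) → ι → ℂ => v ⟨a, Finset.mem_singleton_self a⟩ k *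
          star (v ⟨a, Finset.mem_singleton_self a⟩ j)) (hent s j k).measurable ?_
      exact (by fun_prop : Continuous _).measurable
    have hZint : ∀ j k, Integrable (fun ω => u a ω k * star (u a ω j)) Pr := fun j k =>
      hint {a} (fun v => v ⟨a, Finset.mem_singleton_self a⟩ k *
        star (v ⟨a, Finset.mem_singleton_self a⟩ j)) (by fun_prop)
    have hMZint : ∀ j k, Integrable (fun ω => expNegGram θ (fun i : s => u i ω) j k *
        (u a ω k * star (u a ω j))) Pr := fun j k =>
      (hindep j k).integrable_mul (hint s _ (hent s j k)) (hZint j k)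
    have htrMZ : ∀ ω, (expNegGram θ (fun i : s => u i ω) *
        vecMulVec (u a ω) (star (u a ω))).trace = ∑ j, ∑ k,
          expNegGram θ (fun i : s => u i ω) j k * (u a ω k * star (u a ω j)) := fun ω => by
      simp [trace, mul_apply, vecMulVec_apply]
    have hMZ : Integrable (fun ω => (expNegGram θ (fun i : s => u i ω) *
        vecMulVec (u a ω) (star (u a ω))).trace) Pr := by
      simp only [htrMZ]
      exact integrable_finsetSum _ fun j _ => integrable_finsetSum _ fun k _ => hMZint j k
    -- By independence the expectation factors entrywise, and isotropy replaces the rank-one matrix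
    -- by the identity.
    have hEMZ : ∫ ω, (expNegGram θ (fun i : s => u i ω) *
        vecMulVec (u a ω) (star (u a ω))).trace.re ∂Pr
        = ∫ ω, (expNegGram θ fun i : s => u i ω).trace.re ∂Pr := by
      have e1 : ∫ ω, (expNegGram θ (fun i : s => u i ω) *
          vecMulVec (u a ω) (star (u a ω))).trace ∂Pr
          = ∫ ω, (expNegGram θ fun i : s => u i ω).trace ∂Pr := by
        simp only [htrMZ]
        rw [integral_finsetSum _ fun j _ => integrable_finsetSum _ fun k _ => hMZint j k]
        simp only [trace, diag]
        rw [integral_finsetSum _ fun j _ => hint s _ (hent s j j)]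
        refine Finset.sum_congr rfl fun j _ => ?_
        rw [integral_finsetSum _ fun k _ => hMZint j k]
        have : ∀ k, ∫ ω, expNegGram θ (fun i : s => u i ω) j k * (u a ω k * star (u a ω j)) ∂Pr
            = if k = j then ∫ ω, expNegGram θ (fun i : s => u i ω) j k ∂Pr else 0 := fun k => by
          rw [(hindep j k).integral_fun_mul_eq_mul_integral
            (hint s _ (hent s j k)).aestronglyMeasurable (hZint j k).aestronglyMeasurable, hiso]
          simp
        rw [Finset.sum_congr rfl fun k _ => this k]
        simp
      have e2 := congrArg Complex.re e1
      have h3 := integral_re (𝕜 := ℂ) hMZ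
      have h4 := integral_re (𝕜 := ℂ)
        (hint s (fun v => (expNegGram θ v).trace) (continuous_expNegGram θ).matrix_trace)
      exact h3.trans (e2.trans h4.symm)
    have hnn : 0 ≤ ∫ ω, (expNegGram θ fun i : s => u i ω).trace.re ∂Pr :=
      integral_nonneg fun ω => re_trace_expNegGram_nonneg θ _
    calc _ ≤ ∫ ω, ((expNegGram θ fun i : s => u i ω).trace.re -
          (expNegGram θ (fun i : s => u i ω) *
            vecMulVec (u a ω) (star (u a ω))).trace.re / (2 * κ)) ∂Pr :=
          integral_mono (htr _) ((htr s).sub (hMZ.re.div_const _)) fun ω =>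
            re_trace_expNegGram_insert_le (fun i => u i ω) ha hκ (hu a ω)
      _ = (1 - 1 / (2 * κ)) * ∫ ω, (expNegGram θ fun i : s => u i ω).trace.re ∂Pr := by
          have h := integral_sub (htr s) (hMZ.re.div_const (2 * κ))
          rw [integral_div] at h
          refine h.trans ?_
          rw [show ∫ ω, RCLike.re (expNegGram θ (fun i : s => u i ω) *
            vecMulVec (u a ω) (star (u a ω))).trace ∂Pr = _ from hEMZ]
          ring
      _ ≤ Real.exp (-(1 / (2 * κ))) * (Fintype.card ι * Real.exp (-(s.card / (2 * κ)))) := by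
          refine mul_le_mul ?_ ih hnn (Real.exp_nonneg _)
          have := Real.add_one_le_exp (-(1 / (2 * κ)))
          linarith
      _ = _ := by
          rw [mul_left_comm, ← Real.exp_add, Finset.card_insert_of_notMem ha]
          push_cast
          congr 2
          ring

/-- The lower tail of the matrix Chernoff inequality for isotropic rank-one summands. -/
theorem measureReal_not_posSemidef_gram_le [Nonempty ι] {m : ℕ}
    {u : Fin m → S → ι → ℂ} (hum : ∀ i, Measurable (u i)) (hind : iIndepFun u Pr)
    {κ : ℝ} (hκ : 0 < κ) (hu : ∀ i ω, ∑ j, ‖u i ω j‖ ^ 2 ≤ κ)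
    (hiso : ∀ i j k, ∫ ω, u i ω j * star (u i ω k) ∂Pr = if j = k then 1 else 0) :
    Pr.real {ω | ¬ (∑ i, vecMulVec (u i ω) (star (u i ω)) - ((m / 2 : ℝ) • 1)).PosSemidef}
      ≤ Fintype.card ι * Real.exp (-(m / (8 * κ))) := by
  set θ := Real.log 2 / κ with hθ
  have hθ0 : 0 < θ := div_pos (Real.log_pos one_lt_two) hκ
  obtain ⟨hI, hle⟩ := integral_re_trace_expNegGram_le hum hind hκ hu hiso Finset.univ
  have htrace : ∀ ω, (NormedSpace.exp (-θ • (∑ i, vecMulVec (u i ω) (star (u i ω)) -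
      ((m / 2 : ℝ) • (1 : Matrix ι ι ℂ))))).trace.re = Real.exp (θ * (m / 2)) *
      (expNegGram θ fun i : (Finset.univ : Finset (Fin m)) => u i ω).trace.re := fun ω => by
    have hs : ∑ i : (Finset.univ : Finset (Fin m)), vecMulVec (u i ω) (star (u i ω))
        = ∑ i, vecMulVec (u i ω) (star (u i ω)) :=
      Finset.sum_coe_sort Finset.univ fun i => vecMulVec (u i ω) (star (u i ω))
    have hd : (θ * (m / 2) : ℝ) • (1 : Matrix ι ι ℂ)
        = diagonal fun _ => ((θ * (m / 2) : ℝ) : ℂ) := by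
      rw [← diagonal_one, ← diagonal_smul]; congr 1; ext i; simp
    have he : NormedSpace.exp ((θ * (m / 2) : ℝ) • (1 : Matrix ι ι ℂ))
        = Real.exp (θ * (m / 2)) • (1 : Matrix ι ι ℂ) := by
      rw [hd, Matrix.exp_diagonal, ← diagonal_one, ← diagonal_smul]
      congr 1
      ext i
      rw [Pi.coe_exp, ← Complex.exp_eq_exp_ℂ]
      simp
    rw [expNegGram, hs, smul_sub, smul_smul, sub_eq_add_neg, ← neg_smul, neg_mul, neg_neg,
      Matrix.exp_add_of_commute _ _ ((Commute.one_right _).smul_right _), he,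
      mul_smul_comm, mul_one, trace_smul, Complex.real_smul, Complex.re_ofReal_mul]
  have hsub : {ω | ¬ (∑ i, vecMulVec (u i ω) (star (u i ω)) - ((m / 2 : ℝ) • 1)).PosSemidef}
      ⊆ {ω | 1 ≤ Real.exp (θ * (m / 2)) *
        (expNegGram θ fun i : (Finset.univ : Finset (Fin m)) => u i ω).trace.re} := fun ω hω => by
    rw [Set.mem_ofPred_eq, ← htrace]
    refine IsHermitian.one_le_re_trace_exp (IsHermitian.sub (isHermitian_sum_vecMulVec _) ?_) hω
      (neg_nonpos.2 hθ0.le)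
    rw [IsHermitian, conjTranspose_smul, conjTranspose_one, star_trivial]
  refine (measureReal_mono hsub).trans ?_
  have hmk := mul_meas_ge_le_integral_of_nonneg (μ := Pr)
    (f := fun ω => Real.exp (θ * (m / 2)) *
        (expNegGram θ fun i : (Finset.univ : Finset (Fin m)) => u i ω).trace.re)
    (Filter.Eventually.of_forall fun ω => mul_nonneg (Real.exp_nonneg _)
      (re_trace_expNegGram_nonneg θ _)) (hI.const_mul _) 1
  rw [one_mul, integral_const_mul] at hmk
  refine hmk.trans ((mul_le_mul_of_nonneg_left hle (Real.exp_nonneg _)).trans ?_)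
  rw [mul_left_comm, ← Real.exp_add, Finset.card_univ, Fintype.card_fin]
  refine mul_le_mul_of_nonneg_left (Real.exp_le_exp.2 ?_) (by positivity)
  -- Source of the 8: the exponent is `(m/κ)(log 2 - 1)/2`, at most `-(m/κ)/8` once `log 2 ≤ 3/4`.
  have hlog : Real.log 2 ≤ 3 / 4 := Real.log_two_lt_d9.le.trans (by norm_num)
  have e1 : θ * (m / 2) + -((m : ℝ) / (2 * κ)) = (m / κ) * (Real.log 2 / 2 - 1 / 2) := by
    rw [hθ]; field_simp; ring
  have e2 : -((m : ℝ) / (8 * κ)) = (m / κ) * (-1 / 8) := by field_simp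
  rw [e1, e2]
  exact mul_le_mul_of_nonneg_left (by linarith) (by positivity)

end

/-! ### Orthonormal families and the Christoffel function. -/

section

variable {D : Type*} [MeasurableSpace D]

theorem enorm_sq_eq_ofReal_norm_sq {E : Type*} [SeminormedAddGroup E] (x : E) :
    ‖x‖ₑ ^ 2 = ENNReal.ofReal (‖x‖ ^ 2) := by
  rw [ENNReal.ofReal_pow (norm_nonneg x), ofReal_norm]

/-- An `L²(ν)`-orthonormal family spanning `P` up to `ν`-null sets. -/
theorem exists_orthonormal_family (ν : Measure D) (P : Submodule ℂ (D → ℂ)) [FiniteDimensional ℂ P]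
    (hP : ∀ p ∈ P, MemLp p 2 ν) :
    ∃ r ≤ Module.finrank ℂ P, ∃ (φ : Fin r → D → ℂ) (c : P → Fin r → ℂ), (∀ j, φ j ∈ P) ∧
      (∀ j k, ∫ x, φ j x * star (φ k x) ∂ν = if j = k then 1 else 0) ∧
      (∀ᵐ x ∂ν, ∀ p : P, p.1 x = ∑ j, c p j * φ j x) ∧
      ∀ a : Fin r → ℂ, eLpNorm (fun x => ∑ j, a j * φ j x) 2 ν ^ 2 = ∑ j, ‖a j‖ₑ ^ 2 := by
  -- Distinct elements of `P` may agree ν-almost everywhere, so the family is built in the range of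
  -- `T`, whose rank can drop.
  let T : P →ₗ[ℂ] Lp ℂ 2 ν :=
    { toFun := fun p => (hP p.1 p.2).toLp p.1
      map_add' := fun p q => MemLp.toLp_add (hP p.1 p.2) (hP q.1 q.2)
      map_smul' := fun a p => MemLp.toLp_const_smul a (hP p.1 p.2) }
  let b := stdOrthonormalBasis ℂ (LinearMap.range T)
  choose φ hφ using fun j => LinearMap.mem_range.1 (b j).2
  let c : P →ₗ[ℂ] (Fin (Module.finrank ℂ (LinearMap.range T)) → ℂ) :=
    (WithLp.linearEquiv 2 ℂ _).toLinearMap ∘ₗ b.repr.toLinearEquiv.toLinearMap ∘ₗ T.rangeRestrict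
  have hT : ∀ p : P, (T p : D → ℂ) =ᵐ[ν] p.1 := fun p => MemLp.coeFn_toLp (hP p.1 p.2)
  have hTc : ∀ p : P, T p = T (∑ j, c p j • φ j) := fun p => by
    rw [map_sum]
    simp only [map_smul, hφ]
    have h := congrArg Subtype.val (b.sum_repr (T.rangeRestrict p))
    rw [AddSubmonoidClass.coe_finsetSum] at h
    exact h.symm
  have hcoe : ∀ a : Fin (Module.finrank ℂ (LinearMap.range T)) → ℂ,
      ((∑ j, a j • φ j : P) : D → ℂ) = fun x => ∑ j, a j * (φ j).1 x := fun a => by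
    ext x
    simp [Finset.sum_apply]
  refine ⟨_, LinearMap.finrank_range_le T, fun j => (φ j).1, c, fun j => (φ j).2, fun j k => ?_,
    ?_, fun a => ?_⟩
  · have h := orthonormal_iff_ite.1 b.orthonormal k j
    rw [Submodule.coe_inner, ← hφ, ← hφ, L2.inner_def] at h
    rw [if_congr (Eq.comm (a := j)) rfl rfl, ← h]
    refine integral_congr_ae ?_
    filter_upwards [hT (φ j), hT (φ k)] with x h1 h2
    simp [h1, h2]
  -- A single null set must serve all of `P`: the identity is checked on a finite basis and extended
  -- by linearity of evaluation at `x`.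
  · let B := Module.finBasis ℂ P
    have hB : ∀ᵐ x ∂ν, ∀ i, (B i).1 x = ∑ j, c (B i) j * (φ j).1 x := by
      refine ae_all_iff.2 fun i => ?_
      have h := (hT (B i)).symm.trans ((hTc (B i)) ▸ hT (∑ j, c (B i) j • φ j))
      rw [hcoe] at h
      exact h
    filter_upwards [hB] with x hx p
    let l₁ : P →ₗ[ℂ] ℂ := (LinearMap.proj x) ∘ₗ P.subtype
    let l₂ : P →ₗ[ℂ] ℂ := ∑ j, (φ j).1 x • ((LinearMap.proj j) ∘ₗ c)
    have hl₂ : ∀ p, l₂ p = ∑ j, c p j * (φ j).1 x := fun p => by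
      simp [l₂, LinearMap.sum_apply, mul_comm]
    have : l₁ = l₂ := B.ext fun i => by rw [hl₂]; exact hx i
    rw [← hl₂, ← this]
    rfl
  · have h1 : eLpNorm (fun x => ∑ j, a j * (φ j).1 x) 2 ν = ‖T (∑ j, a j • φ j)‖ₑ := by
      rw [← hcoe]
      exact (Lp.enorm_toLp (hP _ (∑ j, a j • φ j).2)).symm
    have h2 : T (∑ j, a j • φ j) = ((∑ j, a j • b j : LinearMap.range T) : Lp ℂ 2 ν) := by
      rw [map_sum]
      simp [hφ]
    rw [h1, h2, enorm_sq_eq_ofReal_norm_sq, ← Submodule.coe_norm,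
      ← b.repr.norm_map, EuclideanSpace.norm_sq_eq,
      ENNReal.ofReal_sum_of_nonneg fun _ _ => by positivity]
    refine Finset.sum_congr rfl fun j _ => ?_
    rw [enorm_sq_eq_ofReal_norm_sq]
    congr 3
    rw [map_sum]
    simp [b.repr_self, Pi.single_apply]

/-- The diagonal of the reproducing kernel is bounded by the Christoffel function. -/
theorem sum_enorm_sq_le_christoffelFn {ν : Measure D} {P : Submodule ℂ (D → ℂ)} {r : ℕ}
    {φ : Fin r → D → ℂ} (hφ : ∀ j, φ j ∈ P)
    (hnorm : ∀ a : Fin r → ℂ, eLpNorm (fun x => ∑ j, a j * φ j x) 2 ν ^ 2 = ∑ j, ‖a j‖ₑ ^ 2)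
    (x : D) : ∑ j, ‖φ j x‖ₑ ^ 2 ≤ christoffelFn P ν x := by
  set R : ℝ := ∑ j, ‖φ j x‖ ^ 2 with hR
  have hR0 : 0 ≤ R := Finset.sum_nonneg fun _ _ => by positivity
  have hsum : ∑ j, ‖φ j x‖ₑ ^ 2 = ENNReal.ofReal R := by
    rw [hR, ENNReal.ofReal_sum_of_nonneg fun _ _ => by positivity]
    exact Finset.sum_congr rfl fun j _ => enorm_sq_eq_ofReal_norm_sq _
  rw [hsum]
  rcases hR0.eq_or_lt with h0 | h0
  · simp [← h0]
  -- The extremal function is the normalized reproducing kernel at `x`.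
  set a : Fin r → ℂ := fun j => star (φ j x) / (√R : ℂ) with ha
  have hna : ∀ j, ‖a j‖ ^ 2 = ‖φ j x‖ ^ 2 / R := fun j => by
    rw [ha]
    simp only [norm_div, norm_star, Complex.norm_real, div_pow, Real.norm_eq_abs, sq_abs,
      Real.sq_sqrt hR0]
  refine le_sSup ⟨fun x => ∑ j, a j * φ j x, ?_, ?_, ?_⟩
  · have : (fun x => ∑ j, a j * φ j x) = ∑ j, a j • φ j := by ext; simp [Finset.sum_apply]
    rw [this]
    exact Submodule.sum_mem _ fun j _ => P.smul_mem _ (hφ j)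
  · rw [hnorm]
    simp only [enorm_sq_eq_ofReal_norm_sq, hna]
    rw [← ENNReal.ofReal_sum_of_nonneg fun _ _ => by positivity, ← Finset.sum_div, ← hR,
      div_self h0.ne', ENNReal.ofReal_one]
  · have h1 : ∑ j, a j * φ j x = (R : ℂ) / (√R : ℂ) := by
      rw [hR, Complex.ofReal_sum, Finset.sum_div]
      refine Finset.sum_congr rfl fun j _ => ?_
      rw [ha, div_mul_eq_mul_div, ← starRingEnd_apply, Complex.conj_mul', Complex.ofReal_pow]
    simp only [enorm_sq_eq_ofReal_norm_sq, h1]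
    rw [ ← Complex.ofReal_div, Complex.norm_real, Real.div_sqrt,
      Real.norm_eq_abs, sq_abs, Real.sq_sqrt hR0]

/-- The Nikolskii-type inequality `‖p‖_∞ ≤ √κ ‖p‖_2`. -/
theorem eLpNorm_top_le_sqrt_christoffelKappa_mul (ν : Measure D) (P : Submodule ℂ (D → ℂ))
    [FiniteDimensional ℂ P] (hP : ∀ p ∈ P, MemLp p 2 ν) {p : D → ℂ} (hp : p ∈ P) :
    eLpNorm p ∞ ν
      ≤ christoffelKappa P ν (fun _ => 1) ^ (1 / 2 : ℝ) * eLpNorm p 2 ν := by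
  obtain ⟨r, -, φ, c, hφ, -, hae, hnorm⟩ := exists_orthonormal_family ν P hP
  have hpc : eLpNorm p 2 ν = eLpNorm (fun x => ∑ j, c ⟨p, hp⟩ j * φ j x) 2 ν :=
    eLpNorm_congr_ae (hae.mono fun x hx => hx ⟨p, hp⟩)
  have hK : ∀ᵐ x ∂ν, 1 * christoffelFn P ν x ≤ christoffelKappa P ν (fun _ => 1) :=
    ENNReal.ae_le_essSup _
  rw [eLpNorm_exponent_top]
  refine essSup_le_of_ae_le _ ?_
  filter_upwards [hae, hK] with x hx hKx
  rw [one_mul] at hKx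
  have h2 : ‖p x‖ₑ ^ 2 ≤ christoffelKappa P ν (fun _ => 1) * eLpNorm p 2 ν ^ 2 := by
    rw [hpc, hnorm, mul_comm]
    refine le_trans ?_ (mul_le_mul_right ((sum_enorm_sq_le_christoffelFn hφ hnorm x).trans hKx) _)
    simp only [enorm_sq_eq_ofReal_norm_sq]
    rw [← ENNReal.ofReal_sum_of_nonneg fun _ _ => by positivity,
      ← ENNReal.ofReal_sum_of_nonneg fun _ _ => by positivity,
      ← ENNReal.ofReal_mul (Finset.sum_nonneg fun _ _ => by positivity)]
    refine ENNReal.ofReal_le_ofReal ?_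
    have h3 : ‖p x‖ ≤ ∑ j, ‖c ⟨p, hp⟩ j‖ * ‖φ j x‖ := by
      rw [show p x = ∑ j, c ⟨p, hp⟩ j * φ j x from hx ⟨p, hp⟩]
      exact (norm_sum_le _ _).trans_eq (by simp)
    exact (pow_le_pow_left₀ (norm_nonneg _) h3 2).trans (Finset.sum_mul_sq_le_sq_mul_sq _ _ _)
  have h4 := ENNReal.rpow_le_rpow h2 (by norm_num : (0 : ℝ) ≤ 1 / 2)
  rw [ENNReal.mul_rpow_of_nonneg _ _ (by norm_num), ← ENNReal.rpow_natCast,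
    ← ENNReal.rpow_natCast, ← ENNReal.rpow_mul, ← ENNReal.rpow_mul] at h4
  norm_num at h4 ⊢
  exact h4

end

/-! ### Change of measure and the sampled frame bound. -/

section

variable {D : Type*} [MeasurableSpace D] {ϱ μ : Measure D}

theorem measurable_samplingWeight : Measurable (samplingWeight μ ϱ) :=
  (Measure.measurable_rnDeriv μ ϱ).const_div 1

theorem sum_mul_eq_sum_mul_smul {r : ℕ} (s : ℝ) (a v : Fin r → ℂ) :
    ∑ j, a j * (s • v j) = s • ∑ j, a j * v j := by
  rw [Finset.smul_sum]
  exact Finset.sum_congr rfl fun j _ => mul_smul_comm _ _ _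

open Matrix in
theorem sum_norm_sq_le_of_posSemidef_gram_sub {r m : ℕ} {v : Fin m → Fin r → ℂ} {t : ℝ}
    (h : (∑ i, vecMulVec (v i) (star (v i)) - t • 1).PosSemidef) (a : Fin r → ℂ) :
    t * ∑ j, ‖a j‖ ^ 2 ≤ ∑ i, ‖∑ j, a j * v i j‖ ^ 2 := by
  have h1 := (Complex.le_def.1 (h.dotProduct_mulVec_nonneg (star a))).1
  have h2 : ∀ i, (a ⬝ᵥ vecMulVec (v i) (star (v i)) *ᵥ star a).re = ‖∑ j, a j * v i j‖ ^ 2 :=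
    fun i => by
      have : a ⬝ᵥ vecMulVec (v i) (star (v i)) *ᵥ star a = (a ⬝ᵥ v i) * star (a ⬝ᵥ v i) := by
        rw [vecMulVec_mulVec, ← star_dotProduct_star, dotProduct_smul]
        simp [dotProduct_comm]
      rw [this, ← starRingEnd_apply, Complex.mul_conj, Complex.ofReal_re,
        Complex.normSq_eq_norm_sq]
      rfl
  have h3 : (a ⬝ᵥ star a).re = ∑ j, ‖a j‖ ^ 2 := by
    simp only [dotProduct, Pi.star_apply, Complex.re_sum]
    refine Finset.sum_congr rfl fun j _ => ?_
    rw [← starRingEnd_apply, Complex.mul_conj, Complex.ofReal_re, Complex.normSq_eq_norm_sq]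
  rw [star_star, sub_mulVec, dotProduct_sub, sum_mulVec, dotProduct_sum, smul_mulVec, one_mulVec,
    dotProduct_smul, Complex.sub_re, Complex.re_sum, Complex.real_smul, Complex.re_ofReal_mul,
    h3, Finset.sum_congr rfl fun i _ => h2 i] at h1
  simpa using h1

variable [IsProbabilityMeasure ϱ] [IsProbabilityMeasure μ]

/-- The density times its inverse is at most 1; it is 0 where the density vanishes, which is why
equality can fail. -/
theorem lintegral_samplingWeight_mul_le (hμ : μ ≪ ϱ) (h : D → ℝ≥0∞) :
    ∫⁻ x, samplingWeight μ ϱ x * h x ∂μ ≤ ∫⁻ x, h x ∂ϱ := by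
  rw [← Measure.withDensity_rnDeriv_eq μ ϱ hμ]
  refine (lintegral_withDensity_le_lintegral_mul ϱ (Measure.measurable_rnDeriv μ ϱ) _).trans
    (lintegral_mono fun x => ?_)
  rw [Measure.withDensity_rnDeriv_eq μ ϱ hμ, Pi.mul_apply, ← mul_assoc, samplingWeight, one_div]
  exact mul_le_of_le_one_left zero_le (ENNReal.mul_inv_le_one _)

/-- Lower frame bound for the sampled Gram matrix, with high probability. -/
theorem measure_not_frame_bound_le (hμ : μ ≪ ϱ)
    (P : Submodule ℂ (D → ℂ)) [FiniteDimensional ℂ P] (hP : ∀ p ∈ P, MemLp p 2 ϱ)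
    {Ω : Set D} (hΩ : MeasurableSet Ω) (hpos : ∀ᵐ x ∂(ϱ.restrict Ω), 0 < μ.rnDeriv ϱ x)
    {m : ℕ} {K : ℝ} (hK0 : 0 < K)
    (hK : christoffelKappa P (ϱ.restrict Ω) (samplingWeight μ ϱ) ≤ ENNReal.ofReal K)
    {S : Type*} [MeasurableSpace S] (Pr : Measure S) [IsProbabilityMeasure Pr]
    (X : Fin m → S → D) (hXlaw : ∀ i, HasLaw (X i) μ Pr) (hXindep : iIndepFun X Pr) :
    Pr {s | ¬ ∀ p ∈ P, m * eLpNorm p 2 (ϱ.restrict Ω) ^ 2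
        ≤ 2 * ∑ i, samplingWeight μ ϱ (X i s) * ‖p (X i s)‖ₑ ^ 2}
      ≤ ENNReal.ofReal (Module.finrank ℂ P * Real.exp (-(m / (8 * K)))) := by
  set ν := ϱ.restrict Ω with hν
  set w := samplingWeight μ ϱ with hw
  obtain ⟨r, hr, φ, c, hφ, hortho, hae, hnorm⟩ := exists_orthonormal_family ν P
    fun p hp => (hP p hp).mono_measure Measure.restrict_le_self
  rcases Nat.eq_zero_or_pos r with rfl | hr0
  · refine (le_of_eq ?_).trans zero_le
    convert measure_empty (μ := Pr)
    refine Set.eq_empty_iff_forall_notMem.2 fun s hs => hs fun p hp => ?_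
    have : eLpNorm p 2 ν ^ 2 = 0 := by
      rw [eLpNorm_congr_ae (hae.mono fun x hx => hx ⟨p, hp⟩), hnorm]
      simp
    simp [this]
  have : Nonempty (Fin r) := ⟨⟨0, hr0⟩⟩
  -- measurable representatives of the weighted basis, truncated on a null set
  let φ' : Fin r → D → ℂ := fun j => (hP _ (hφ j)).aestronglyMeasurable.mk (φ j)
  have hφ'm : ∀ j, Measurable (φ' j) := fun j =>
    (hP _ (hφ j)).aestronglyMeasurable.stronglyMeasurable_mk.measurable
  have hφ' : ∀ᵐ x ∂ϱ, ∀ j, φ j x = φ' j x := ae_all_iff.2 fun j =>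
    (hP _ (hφ j)).aestronglyMeasurable.ae_eq_mk
  let V : D → Fin r → ℂ := fun x j => Ω.indicator (fun x => √(w x).toReal • φ' j x) x
  have hVm : Measurable V := measurable_pi_lambda _ fun j =>
    ((measurable_samplingWeight.ennreal_toReal.sqrt).smul (hφ'm j)).indicator hΩ
  -- The Chernoff bound asks for `|U|² ≤ K` everywhere, whereas `V` satisfies it only almost
  -- everywhere.
  let U : D → Fin r → ℂ := {x | ∑ j, ‖V x j‖ ^ 2 ≤ K}.indicator V
  have hUm : Measurable U := hVm.indicator (measurableSet_le (Finset.measurable_sum _ fun j _ =>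
    ((measurable_pi_apply j).comp hVm).norm.pow_const 2) measurable_const)
  have hUK : ∀ x, ∑ j, ‖U x j‖ ^ 2 ≤ K := fun x => by
    by_cases hx : ∑ j, ‖V x j‖ ^ 2 ≤ K
    · have : U x = V x := Set.indicator_of_mem (s := {x | ∑ j, ‖V x j‖ ^ 2 ≤ K}) hx V
      rwa [this]
    · have : U x = 0 := Set.indicator_of_notMem (s := {x | ∑ j, ‖V x j‖ ^ 2 ≤ K}) hx V
      simp [this, hK0.le]
  have hwK : ∀ᵐ x ∂ν, w x * christoffelFn P ν x ≤ ENNReal.ofReal K :=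
    (ENNReal.ae_le_essSup fun x => w x * christoffelFn P ν x).mono fun x hx => hx.trans hK
  have hwtop : ∀ᵐ x ∂ν, w x ≠ ∞ := hpos.mono fun x hx => by
    simpa [hw, samplingWeight] using hx.ne'
  have hUφ : ∀ᵐ x ∂ϱ, ∀ j, U x j = Ω.indicator (fun x => √(w x).toReal • φ j x) x := by
    filter_upwards [hφ', (ae_restrict_iff' hΩ).1 hwK, (ae_restrict_iff' hΩ).1 hwtop]
      with x h1 h2 h3 j
    have hVx : ∑ j, ‖V x j‖ ^ 2 ≤ K := by
      by_cases hx : x ∈ Ω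
      · have h4 : ∀ j, ‖V x j‖ ^ 2 = (w x).toReal * ‖φ j x‖ ^ 2 := fun j => by
          simp only [V, Set.indicator_of_mem hx, norm_smul, mul_pow, ← h1,
            Real.norm_eq_abs, sq_abs, Real.sq_sqrt ENNReal.toReal_nonneg]
        rw [Finset.sum_congr rfl fun j _ => h4 j, ← Finset.mul_sum,
          ← ENNReal.ofReal_le_ofReal_iff hK0.le, ENNReal.ofReal_mul ENNReal.toReal_nonneg,
          ENNReal.ofReal_toReal (h3 hx), ENNReal.ofReal_sum_of_nonneg fun _ _ => by positivity]
        simp only [← enorm_sq_eq_ofReal_norm_sq]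
        exact (mul_le_mul_right (sum_enorm_sq_le_christoffelFn hφ hnorm x) _).trans (h2 hx)
      · simp [V, hx, hK0.le]
    have : U x = V x := Set.indicator_of_mem (s := {x | ∑ j, ‖V x j‖ ^ 2 ≤ K}) hVx V
    rw [this]
    by_cases hx : x ∈ Ω <;> simp [V, hx, h1 j]
  -- On Ω the density cancels `(√w)²`, turning the μ-integral into orthonormality over Ω.
  have hisoμ : ∀ j k, ∫ x, U x j * star (U x k) ∂μ = if j = k then 1 else 0 := fun j k => by
    rw [← integral_rnDeriv_smul hμ, ← hortho, hν, ← integral_indicator hΩ]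
    refine integral_congr_ae ?_
    filter_upwards [hUφ, (ae_restrict_iff' hΩ).1 hwtop, (ae_restrict_iff' hΩ).1 hpos,
      Measure.rnDeriv_lt_top μ ϱ] with x h1 h2 h3 h4
    rw [h1, h1]
    by_cases hx : x ∈ Ω
    · simp only [Set.indicator_of_mem hx]
      have hs : (√(w x).toReal : ℂ) * √(w x).toReal = ((w x).toReal : ℂ) := by
        rw [← Complex.ofReal_mul, Real.mul_self_sqrt ENNReal.toReal_nonneg]
      have hone : ((μ.rnDeriv ϱ x).toReal : ℂ) * (w x).toReal = 1 := by
        rw [← Complex.ofReal_mul, ← ENNReal.toReal_mul, hw, samplingWeight, one_div,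
          ENNReal.mul_inv_cancel (h3 hx).ne' h4.ne]
        simp
      simp only [Complex.real_smul, star_mul', Complex.star_def, Complex.conj_ofReal]
      linear_combination (φ j x * (starRingEnd ℂ) (φ k x)) * hone +
        ((μ.rnDeriv ϱ x).toReal : ℂ) * (φ j x * (starRingEnd ℂ) (φ k x)) * hs
    · simp [hx]
  -- Samples outside Ω give `U = 0` and can only help the right-hand side.
  have hgood : ∀ᵐ x ∂μ, ∀ p : P, ‖∑ j, c p j * U x j‖ₑ ^ 2 ≤ w x * ‖p.1 x‖ₑ ^ 2 := by
    refine hμ.ae_le ?_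
    filter_upwards [hUφ, (ae_restrict_iff' hΩ).1 hae, (ae_restrict_iff' hΩ).1 hwtop]
      with x h1 h2 h3 p
    simp only [h1]
    by_cases hx : x ∈ Ω
    · simp only [Set.indicator_of_mem hx]
      rw [sum_mul_eq_sum_mul_smul, ← h2 hx p, enorm_sq_eq_ofReal_norm_sq,
        enorm_sq_eq_ofReal_norm_sq, norm_smul, mul_pow, Real.norm_eq_abs, sq_abs,
        Real.sq_sqrt ENNReal.toReal_nonneg, ENNReal.ofReal_mul ENNReal.toReal_nonneg,
        ENNReal.ofReal_toReal (h3 hx)]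
    · simp [hx]
  -- measurable versions of the samples
  let Y : Fin m → S → D := fun i => (hXlaw i).aemeasurable.mk (X i)
  have hYm : ∀ i, Measurable (Y i) := fun i => (hXlaw i).aemeasurable.measurable_mk
  have hXY : ∀ i, X i =ᵐ[Pr] Y i := fun i => (hXlaw i).aemeasurable.ae_eq_mk
  have hYlaw : ∀ i, HasLaw (Y i) μ Pr := fun i => (hXlaw i).congr (hXY i).symm
  have hYindep : iIndepFun Y Pr := hXindep.congr hXY
  have hisoY : ∀ i j k, ∫ s, U (Y i s) j * star (U (Y i s) k) ∂Pr = if j = k then 1 else 0 :=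
    fun i j k => by
      rw [← hisoμ, ← (hYlaw i).map_eq, integral_map (hYm i).aemeasurable]
      exact (((measurable_pi_apply j).comp hUm).mul
        (continuous_star.measurable.comp ((measurable_pi_apply k).comp hUm))).aestronglyMeasurable
  have hch := measureReal_not_posSemidef_gram_le (Pr := Pr) (u := fun i s => U (Y i s))
    (fun i => hUm.comp (hYm i)) (hYindep.comp (fun _ => U) fun _ => hUm) hK0
    (fun i s => hUK _) hisoY
  have hall : ∀ᵐ s ∂Pr, ∀ i, X i s = Y i s ∧
      ∀ p : P, ‖∑ j, c p j * U (Y i s) j‖ₑ ^ 2 ≤ w (Y i s) * ‖p.1 (Y i s)‖ₑ ^ 2 :=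
    ae_all_iff.2 fun i => (hXY i).and
      (ae_of_ae_map (hYm i).aemeasurable ((hYlaw i).map_eq.symm ▸ hgood))
  refine (measure_mono_ae (t := {s | ¬ (∑ i, Matrix.vecMulVec (U (Y i s)) (star (U (Y i s))) -
    ((m / 2 : ℝ) • 1)).PosSemidef}) ?_).trans ?_
  · filter_upwards [hall] with s hs hbad hpsd
    refine hbad fun p hp => ?_
    have h1 := sum_norm_sq_le_of_posSemidef_gram_sub hpsd (c ⟨p, hp⟩)
    rw [eLpNorm_congr_ae (hae.mono fun x hx => hx ⟨p, hp⟩), hnorm]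
    have h2 : ∑ i, ‖∑ j, c ⟨p, hp⟩ j * U (Y i s) j‖ₑ ^ 2
        ≤ ∑ i, w (X i s) * ‖p (X i s)‖ₑ ^ 2 := Finset.sum_le_sum fun i _ => by
      rw [(hs i).1]; exact (hs i).2 ⟨p, hp⟩
    refine le_trans ?_ (mul_le_mul_right h2 2)
    simp only [enorm_sq_eq_ofReal_norm_sq]
    rw [← ENNReal.ofReal_sum_of_nonneg fun _ _ => by positivity,
      ← ENNReal.ofReal_sum_of_nonneg fun _ _ => by positivity, ← ENNReal.ofReal_natCast,
      ← ENNReal.ofReal_ofNat 2, ← ENNReal.ofReal_mul (by positivity),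
      ← ENNReal.ofReal_mul (by positivity)]
    exact ENNReal.ofReal_le_ofReal (by linarith)
  · rw [← ofReal_measureReal]
    refine ENNReal.ofReal_le_ofReal (hch.trans ?_)
    rw [Fintype.card_fin]
    gcongr

end

/-! ### Markov bounds, stability and the sampling event. -/

section

/-- Markov's inequality for the strict upper level sets, including the bound `B = 0`. -/
theorem measure_lt_le_of_lintegral_le {S : Type*} [MeasurableSpace S] {Pr : Measure S}
    {F : S → ℝ≥0∞} (hF : AEMeasurable F Pr) {B t : ℝ≥0∞} (hB : B ≠ ∞) (ht0 : t ≠ 0) (ht : t ≠ ∞)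
    (h : ∫⁻ s, F s ∂Pr ≤ B) : Pr {s | B / t < F s} ≤ t := by
  rcases eq_or_ne B 0 with rfl | hB0
  · have h0 : F =ᵐ[Pr] 0 := (lintegral_eq_zero_iff' hF).1 (le_antisymm h zero_le)
    refine (le_of_eq ?_).trans zero_le
    refine measure_mono_null (fun s hs => ?_) h0
    simp only [ENNReal.zero_div] at hs
    exact hs.ne'
  · have hc0 : B / t ≠ 0 := ENNReal.div_ne_zero.2 ⟨hB0, ht⟩
    have hct : B / t ≠ ∞ := ENNReal.div_ne_top hB ht0
    calc Pr {s | B / t < F s} ≤ Pr {s | B / t ≤ F s} :=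
          measure_mono fun s hs => le_of_lt (α := ℝ≥0∞) hs
      _ ≤ (∫⁻ s, F s ∂Pr) / (B / t) := meas_ge_le_lintegral_div hF hc0 hct
      _ ≤ B / (B / t) := ENNReal.div_le_div_right h _
      _ ≤ t := ENNReal.div_le_of_le_mul (by rw [ENNReal.mul_div_cancel ht0 ht])

/-- The density is finite almost everywhere, so `w > 0`, and a zero constant would make the
Christoffel function vanish on Ω. The sup-norm inequality would then force the constant 1 to be zero
there. -/
theorem christoffelKappa_samplingWeight_ne_zero {D : Type*} [MeasurableSpace D]
    {ϱ μ : Measure D} [IsProbabilityMeasure μ] (P : Submodule ℂ (D → ℂ)) [FiniteDimensional ℂ P]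
    (hP : ∀ p ∈ P, MemLp p 2 ϱ) (hone : ∃ p ∈ P, p =ᵐ[ϱ] fun _ => (1 : ℂ))
    {Ω : Set D} (hΩ : ϱ.restrict Ω ≠ 0) :
    christoffelKappa P (ϱ.restrict Ω) (samplingWeight μ ϱ) ≠ 0 := fun h0 => by
  have h1 : ∀ᵐ x ∂ϱ.restrict Ω, christoffelFn P (ϱ.restrict Ω) x = 0 := by
    filter_upwards [ENNReal.ae_le_essSup (μ := ϱ.restrict Ω)
      fun x => samplingWeight μ ϱ x * christoffelFn P (ϱ.restrict Ω) x,
      ae_restrict_of_ae (Measure.rnDeriv_lt_top μ ϱ)] with x hx hlt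
    have h2 := le_antisymm (hx.trans_eq h0) zero_le
    refine (mul_eq_zero.1 h2).resolve_left ?_
    simpa [samplingWeight] using hlt.ne
  have h2 : christoffelKappa P (ϱ.restrict Ω) (fun _ => 1) = 0 := by
    refine ENNReal.essSup_eq_zero_iff.2 (h1.mono fun x hx => ?_)
    simp [hx]
  obtain ⟨p, hp, hp1⟩ := hone
  have h3 := eLpNorm_top_le_sqrt_christoffelKappa_mul (ϱ.restrict Ω) P
    (fun p hp => (hP p hp).mono_measure Measure.restrict_le_self) hp
  rw [h2, ENNReal.zero_rpow_of_pos (by norm_num), zero_mul, nonpos_iff_eq_zero,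
    eLpNorm_congr_ae (ae_restrict_of_ae hp1), eLpNorm_const _ ENNReal.top_ne_zero hΩ] at h3
  simp at h3

variable {D : Type*} [MeasurableSpace D] {ϱ μ : Measure D}
  [IsProbabilityMeasure ϱ] [IsProbabilityMeasure μ]

theorem measure_lt_sum_samplingWeight_mul_le (hμ : μ ≪ ϱ) {m : ℕ}
    {S : Type*} [MeasurableSpace S] (Pr : Measure S)
    (X : Fin m → S → D) (hXlaw : ∀ i, HasLaw (X i) μ Pr)
    {G : D → ℝ≥0∞} (hG : AEMeasurable G ϱ) {B t : ℝ≥0∞} (hB : B ≠ ∞) (ht0 : t ≠ 0) (ht : t ≠ ∞)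
    (h : ∫⁻ x, G x ∂ϱ ≤ B) :
    Pr {s | m * B / t < ∑ i, samplingWeight μ ϱ (X i s) * G (X i s)} ≤ t := by
  have hwG : AEMeasurable (fun x => samplingWeight μ ϱ x * G x) μ :=
    measurable_samplingWeight.aemeasurable.mul (hG.mono_ac hμ)
  have hwGX : ∀ i, AEMeasurable (fun s => samplingWeight μ ϱ (X i s) * G (X i s)) Pr := fun i => by
    refine AEMeasurable.comp_aemeasurable (g := fun x => samplingWeight μ ϱ x * G x) ?_
      (hXlaw i).aemeasurable
    rwa [(hXlaw i).map_eq]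
  refine measure_lt_le_of_lintegral_le (Finset.aemeasurable_fun_sum _ fun i _ => hwGX i)
    (ENNReal.mul_ne_top (ENNReal.natCast_ne_top m) hB) ht0 ht ?_
  rw [lintegral_finsetSum' _ fun i _ => hwGX i]
  calc _ ≤ ∑ _i : Fin m, B := Finset.sum_le_sum fun i _ => by
        rw [← lintegral_map' (f := fun x => samplingWeight μ ϱ x * G x)
          (by rwa [(hXlaw i).map_eq]) (hXlaw i).aemeasurable, (hXlaw i).map_eq]
        exact (lintegral_samplingWeight_mul_le hμ G).trans h
    _ = m * B := by simp

theorem enorm_add_sq_le (a b : ℂ) : ‖a + b‖ₑ ^ 2 ≤ 2 * ‖a‖ₑ ^ 2 + 2 * ‖b‖ₑ ^ 2 := by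
  simp only [enorm_sq_eq_ofReal_norm_sq]
  rw [← ENNReal.ofReal_ofNat 2, ← ENNReal.ofReal_mul (by norm_num),
    ← ENNReal.ofReal_mul (by norm_num), ← ENNReal.ofReal_add (by positivity) (by positivity)]
  refine ENNReal.ofReal_le_ofReal ?_
  have h := pow_le_pow_left₀ (norm_nonneg _) (norm_add_le a b) 2
  nlinarith [sq_nonneg (‖a‖ - ‖b‖)]

theorem sum_mul_enorm_add_sq_le {m : ℕ} (w : Fin m → ℝ≥0∞) (a b : Fin m → ℂ) :
    ∑ i, w i * ‖a i + b i‖ₑ ^ 2 ≤ 2 * ∑ i, w i * ‖a i‖ₑ ^ 2 + 2 * ∑ i, w i * ‖b i‖ₑ ^ 2 := by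
  rw [Finset.mul_sum, Finset.mul_sum, ← Finset.sum_add_distrib]
  refine Finset.sum_le_sum fun i _ => ?_
  calc _ ≤ w i * (2 * ‖a i‖ₑ ^ 2 + 2 * ‖b i‖ₑ ^ 2) := mul_le_mul_right (enorm_add_sq_le _ _) _
    _ = _ := by ring

/-- Each `|eᵢ|` is bounded by `‖e‖₂`, so control of `∑ w` suffices for every noise vector
simultaneously. -/
theorem sum_mul_enorm_sq_le_mul {m : ℕ} (w : Fin m → ℝ≥0∞) (e : EuclideanSpace ℂ (Fin m)) :
    ∑ i, w i * ‖e i‖ₑ ^ 2 ≤ (∑ i, w i) * ‖e‖ₑ ^ 2 := by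
  rw [Finset.sum_mul]
  refine Finset.sum_le_sum fun i _ => mul_le_mul_right ?_ _
  rw [enorm_sq_eq_ofReal_norm_sq, enorm_sq_eq_ofReal_norm_sq]
  exact ENNReal.ofReal_le_ofReal (pow_le_pow_left₀ (norm_nonneg _) (PiLp.norm_apply_le e i) 2)

/-- Stability of weighted least squares, given a lower frame bound and upper bounds on the data. -/
theorem IsWLSMinimizer.eLpNorm_sub_sq_le {ν : Measure D} {P : Submodule ℂ (D → ℂ)} {m : ℕ}
    (hm : m ≠ 0) {w : D → ℝ≥0∞} {x : Fin m → D} {f fn fhat : D → ℂ}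
    {e : EuclideanSpace ℂ (Fin m)} (hfn : fn ∈ P)
    (hmin : IsWLSMinimizer P w x (fun i => f (x i) + e i) fhat) {B t : ℝ≥0∞}
    (hframe : ∀ p ∈ P, m * eLpNorm p 2 ν ^ 2 ≤ 2 * ∑ i, w (x i) * ‖p (x i)‖ₑ ^ 2)
    (hg : ∑ i, w (x i) * ‖(f - fn) (x i)‖ₑ ^ 2 ≤ m * B / t)
    (hw : ∑ i, w (x i) ≤ m / t) :
    eLpNorm (fhat - fn) 2 ν ^ 2 ≤ 16 / t * (B + ‖e‖ₑ ^ 2) := by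
  have hm0 : (m : ℝ≥0∞) ≠ 0 := by exact_mod_cast hm
  have hmt : (m : ℝ≥0∞) ≠ ∞ := ENNReal.natCast_ne_top m
  set R : (D → ℂ) → ℝ≥0∞ := fun p => ∑ i, w (x i) * ‖f (x i) + e i - p (x i)‖ₑ ^ 2 with hR
  have h1 : R fhat ≤ R fn := by
    have h := hmin.2 fn hfn
    unfold wlsObjective at h
    exact (ENNReal.mul_le_mul_iff_right (by simp) (by simpa using hm)).1 h
  have h2 : R fn ≤ 2 * (m * B / t) + 2 * (m / t * ‖e‖ₑ ^ 2) := by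
    have h := sum_mul_enorm_add_sq_le (fun i => w (x i)) (fun i => (f - fn) (x i)) e
    calc R fn = ∑ i, w (x i) * ‖(f - fn) (x i) + e i‖ₑ ^ 2 := by
          refine Finset.sum_congr rfl fun i _ => ?_
          rw [Pi.sub_apply, add_sub_right_comm]
      _ ≤ _ := h
      _ ≤ _ := add_le_add (mul_le_mul_right hg 2) (mul_le_mul_right
          ((sum_mul_enorm_sq_le_mul _ e).trans (mul_le_mul_left hw _)) 2)
  have h3 : ∑ i, w (x i) * ‖(fhat - fn) (x i)‖ₑ ^ 2 ≤ 2 * R fn + 2 * R fhat := by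
    have h := sum_mul_enorm_add_sq_le (fun i => w (x i)) (fun i => f (x i) + e i - fn (x i))
      (fun i => -(f (x i) + e i - fhat (x i)))
    simp only [enorm_neg] at h
    refine le_of_eq_of_le (Finset.sum_congr rfl fun i _ => ?_) h
    rw [Pi.sub_apply]
    congr 3
    ring
  -- The 16 is 2 (frame bound) times 4 (splitting through the data, then minimality) times 2
  -- (splitting the residual of `fn`).
  have h4 : m * eLpNorm (fhat - fn) 2 ν ^ 2 ≤ m * (16 / t * (B + ‖e‖ₑ ^ 2)) :=
    calc _ ≤ 2 * (2 * R fn + 2 * R fhat) :=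
          (hframe _ (P.sub_mem hmin.1 hfn)).trans (mul_le_mul_right h3 2)
      _ ≤ 2 * (2 * R fn + 2 * R fn) := by gcongr
      _ = 8 * R fn := by ring
      _ ≤ 8 * (2 * (m * B / t) + 2 * (m / t * ‖e‖ₑ ^ 2)) := mul_le_mul_right h2 8
      _ = _ := by simp only [div_eq_mul_inv]; ring
  exact (ENNReal.mul_le_mul_iff_right hm0 hmt).1 h4

/-- With `t = ε/3` the constant `16/t = 48/ε` is rounded up to `64/ε = (8/√ε)²`. -/
theorem le_ofReal_mul_add_of_sq_le {ε : ℝ} (hε : 0 < ε) {a b d : ℝ≥0∞}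
    (h : d ^ 2 ≤ 16 / ENNReal.ofReal (ε / 3) * (a ^ 2 + b ^ 2)) :
    d ≤ ENNReal.ofReal (8 / √ε) * (a + b) := by
  have h8 : ENNReal.ofReal (8 / √ε) ^ 2 = ENNReal.ofReal (64 / ε) := by
    rw [← ENNReal.ofReal_pow (by positivity), div_pow, Real.sq_sqrt hε.le]
    norm_num
  have h16 : 16 / ENNReal.ofReal (ε / 3) ≤ ENNReal.ofReal (64 / ε) := by
    rw [← ENNReal.ofReal_ofNat 16, ← ENNReal.ofReal_div_of_pos (by positivity)]
    refine ENNReal.ofReal_le_ofReal ?_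
    rw [div_div_eq_mul_div]
    gcongr
    norm_num
  refine (ENNReal.pow_right_strictMono two_ne_zero).le_iff_le.1 (h.trans ?_)
  rw [mul_pow, h8]
  refine mul_le_mul' h16 ?_
  calc a ^ 2 + b ^ 2 ≤ a ^ 2 + b ^ 2 + 2 * a * b := le_self_add
    _ = _ := by ring

theorem exists_measurableSet_sampling_event (hμ : μ ≪ ϱ)
    (P : Submodule ℂ (D → ℂ)) [FiniteDimensional ℂ P] (hP : ∀ p ∈ P, MemLp p 2 ϱ)
    (hn : 0 < Module.finrank ℂ P)
    {Ω : Set D} (hΩ : MeasurableSet Ω) (hpos : ∀ᵐ x ∂(ϱ.restrict Ω), 0 < μ.rnDeriv ϱ x)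
    {g : D → ℂ} (hg : MemLp g 2 ϱ) {ε : ℝ} (hε0 : 0 < ε) {m : ℕ} {K : ℝ} (hK0 : 0 < K)
    (hK : christoffelKappa P (ϱ.restrict Ω) (samplingWeight μ ϱ) ≤ ENNReal.ofReal K)
    (hm : 8 * K * Real.log (3 * Module.finrank ℂ P / ε) ≤ m)
    {S : Type*} [MeasurableSpace S] (Pr : Measure S) [IsProbabilityMeasure Pr]
    (X : Fin m → S → D) (hXlaw : ∀ i, HasLaw (X i) μ Pr) (hXindep : iIndepFun X Pr) :
    ∃ A : Set S, MeasurableSet A ∧ ENNReal.ofReal (1 - ε) ≤ Pr A ∧ ∀ s ∈ A,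
      (∀ p ∈ P, m * eLpNorm p 2 (ϱ.restrict Ω) ^ 2
        ≤ 2 * ∑ i, samplingWeight μ ϱ (X i s) * ‖p (X i s)‖ₑ ^ 2) ∧
      ∑ i, samplingWeight μ ϱ (X i s) * ‖g (X i s)‖ₑ ^ 2
        ≤ m * eLpNorm g 2 ϱ ^ 2 / ENNReal.ofReal (ε / 3) ∧
      ∑ i, samplingWeight μ ϱ (X i s) ≤ m / ENNReal.ofReal (ε / 3) := by
  have ht0 : ENNReal.ofReal (ε / 3) ≠ 0 := (ENNReal.ofReal_pos.2 (by positivity)).ne'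
  have hint : ∫⁻ x, ‖g x‖ₑ ^ 2 ∂ϱ ≤ eLpNorm g 2 ϱ ^ 2 := by
    have h := eLpNorm_nnreal_pow_eq_lintegral (f := g) (μ := ϱ) (p := 2) two_ne_zero
    norm_num at h
    exact h.ge
  have e1 := measure_not_frame_bound_le hμ P hP hΩ hpos hK0 hK Pr X hXlaw hXindep
  have e2 := measure_lt_sum_samplingWeight_mul_le hμ Pr X hXlaw
    (hg.aestronglyMeasurable.enorm.pow_const 2)
    (ENNReal.pow_ne_top hg.eLpNorm_ne_top) ht0 ENNReal.ofReal_ne_top hint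
  have e3 := measure_lt_sum_samplingWeight_mul_le hμ Pr X hXlaw (G := fun _ => 1) (B := 1)
    aemeasurable_const ENNReal.one_ne_top ht0 ENNReal.ofReal_ne_top (by simp)
  simp only [mul_one] at e3
  have e1' : Module.finrank ℂ P * Real.exp (-(m / (8 * K))) ≤ ε / 3 := by
    have hn' : (0 : ℝ) < Module.finrank ℂ P := by exact_mod_cast hn
    have h : Real.log (3 * Module.finrank ℂ P / ε) ≤ m / (8 * K) := by
      rw [le_div_iff₀ (by positivity), mul_comm]; exact hm
    calc _ ≤ (Module.finrank ℂ P : ℝ) * Real.exp (-Real.log (3 * Module.finrank ℂ P / ε)) := by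
          gcongr
      _ = ε / 3 := by
          rw [Real.exp_neg, Real.exp_log (by positivity)]
          field_simp
  replace e1 := e1.trans (ENNReal.ofReal_le_ofReal e1')
  set E1 := {s | ¬ ∀ p ∈ P, m * eLpNorm p 2 (ϱ.restrict Ω) ^ 2
        ≤ 2 * ∑ i, samplingWeight μ ϱ (X i s) * ‖p (X i s)‖ₑ ^ 2}
  set E2 := {s | m * eLpNorm g 2 ϱ ^ 2 / ENNReal.ofReal (ε / 3)
    < ∑ i, samplingWeight μ ϱ (X i s) * ‖g (X i s)‖ₑ ^ 2}
  set E3 := {s | m / ENNReal.ofReal (ε / 3) < ∑ i, samplingWeight μ ϱ (X i s)}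
  -- The failure sets need not be measurable, so their union is replaced by a measurable hull of
  -- equal measure.
  refine ⟨(toMeasurable Pr (E1 ∪ (E2 ∪ E3)))ᶜ, (measurableSet_toMeasurable _ _).compl, ?_,
    fun s hs => ?_⟩
  · rw [prob_compl_eq_one_sub (measurableSet_toMeasurable _ _), measure_toMeasurable,
      ENNReal.ofReal_sub _ hε0.le, ENNReal.ofReal_one]
    refine tsub_le_tsub_left ?_ _
    calc _ ≤ Pr E1 + (Pr E2 + Pr E3) :=
          (measure_union_le _ _).trans (add_le_add_right (measure_union_le _ _) _)
      _ ≤ ENNReal.ofReal (ε / 3) + (ENNReal.ofReal (ε / 3) + ENNReal.ofReal (ε / 3)) :=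
          add_le_add e1 (add_le_add e2 e3)
      _ = _ := by
          rw [← ENNReal.ofReal_add (by positivity) (by positivity),
            ← ENNReal.ofReal_add (by positivity) (by positivity)]
          congr 1; ring
  · have hs' : s ∉ E1 ∪ (E2 ∪ E3) := fun h => hs (subset_toMeasurable _ _ h)
    simp only [Set.mem_union, not_or] at hs'
    exact ⟨not_not.1 hs'.1, not_lt.1 hs'.2.1, not_lt.1 hs'.2.2⟩

end

/-! ### The error bounds. -/

theorem mainTheorem2
    {D : Type*} [MeasurableSpace D] (ϱ μ : Measure D)
    [IsProbabilityMeasure ϱ] [IsProbabilityMeasure μ] (hμ : μ ≪ ϱ)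
    -- the approximation space: an `n`-dimensional space of square-integrable functions, `1 ∈ P`
    (P : Submodule ℂ (D → ℂ)) [FiniteDimensional ℂ P] (hP : ∀ p ∈ P, MemLp p 2 ϱ)
    (n : ℕ) (hn : Module.finrank ℂ P = n)
    (hone : ∃ p ∈ P, p =ᵐ[ϱ] fun _ => (1 : ℂ))
    -- the subdomain, on which the sampling density is positive
    (Ω : Set D) (hΩ : NullMeasurableSet Ω ϱ)
    (hpos : ∀ᵐ x ∂(ϱ.restrict Ω), 0 < μ.rnDeriv ϱ x)
    (f : D → ℂ) (hf : MemLp f 2 ϱ)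
    (fn : D → ℂ) (hfn : IsBestL2Approx P ϱ f fn)
    (ε : ℝ) (hε0 : 0 < ε) (hε1 : ε < 1)
    (κ : ℝ≥0∞) (hκ : κ = christoffelKappa P (ϱ.restrict Ω) (fun _ => 1))
    (m : ℕ)
    (hm : 8 * christoffelKappa P (ϱ.restrict Ω) (samplingWeight μ ϱ)
        * ENNReal.ofReal (Real.log (3 * n / ε)) ≤ (m : ℝ≥0∞))
    -- `m` i.i.d. samples from `μ`
    {S : Type*} [MeasurableSpace S] (Pr : Measure S) [IsProbabilityMeasure Pr]
    (X : Fin m → S → D) (hXlaw : ∀ i, HasLaw (X i) μ Pr) (hXindep : iIndepFun X Pr) :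
    ∃ A : Set S, MeasurableSet A ∧ ENNReal.ofReal (1 - ε) ≤ Pr A ∧
      ∀ s ∈ A, ∀ e : EuclideanSpace ℂ (Fin m), ∀ fhat : D → ℂ,
        IsWLSMinimizer P (samplingWeight μ ϱ) (fun i => X i s)
          (fun i => f (X i s) + e i) fhat →
        eLpNorm (f - fhat) 2 (ϱ.restrict Ω)
            ≤ ENNReal.ofReal (9 / √ε) * eLpNorm (f - fn) 2 ϱ
              + ENNReal.ofReal (8 / √ε) * ‖e‖ₑ ∧
        eLpNorm (f - fhat) ∞ (ϱ.restrict Ω)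
            ≤ eLpNorm (f - fn) ∞ (ϱ.restrict Ω)
              + 8 * (κ / ENNReal.ofReal ε) ^ (1 / 2 : ℝ) * eLpNorm (f - fn) 2 ϱ
              + 8 * (κ / ENNReal.ofReal ε) ^ (1 / 2 : ℝ) * ‖e‖ₑ := by
  obtain ⟨Ω', -, hΩ', hΩΩ'⟩ := hΩ.exists_measurable_superset_ae_eq
  rw [← Measure.restrict_congr_set hΩΩ'] at hpos hκ hm ⊢
  rcases eq_or_ne (ϱ.restrict Ω') 0 with h0 | h0
  · refine ⟨Set.univ, MeasurableSet.univ, ?_, fun s _ e fhat _ => ?_⟩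
    · rw [measure_univ]
      exact ENNReal.ofReal_le_one.2 (by linarith)
    · simp [h0]
  have hn0 : 0 < n := by
    rw [← hn, Module.finrank_pos_iff]
    obtain ⟨p, hp, hp1⟩ := hone
    refine ⟨⟨⟨p, hp⟩, 0, fun h => ?_⟩⟩
    obtain ⟨x, hx⟩ := hp1.exists
    have := congrFun (congrArg Subtype.val h) x
    simp [hx] at this
  have hn1 : (1 : ℝ) ≤ n := by exact_mod_cast hn0
  have hlog : 0 < Real.log (3 * n / ε) := by
    refine Real.log_pos ?_
    rw [one_lt_div hε0]
    linarith
  set Kw := christoffelKappa P (ϱ.restrict Ω') (samplingWeight μ ϱ) with hKw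
  have hKw0 : Kw ≠ 0 := christoffelKappa_samplingWeight_ne_zero P hP hone h0
  -- The logarithm is positive, so an infinite constant would force `m = ∞`.
  have hKwt : Kw ≠ ∞ := fun h => by
    rw [h, ENNReal.mul_top (by norm_num), ENNReal.top_mul (ENNReal.ofReal_pos.2 hlog).ne',
      top_le_iff] at hm
    exact ENNReal.natCast_ne_top m hm
  have hK0 : 0 < Kw.toReal := ENNReal.toReal_pos hKw0 hKwt
  have hm' : 8 * Kw.toReal * Real.log (3 * n / ε) ≤ m := by
    have h := ENNReal.toReal_mono (ENNReal.natCast_ne_top m) hm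
    rw [ENNReal.toReal_mul, ENNReal.toReal_mul, ENNReal.toReal_ofReal hlog.le] at h
    simpa using h
  have hm0 : m ≠ 0 := by
    rintro rfl
    have : 0 < 8 * Kw.toReal * Real.log (3 * n / ε) := by positivity
    simp only [Nat.cast_zero] at hm'
    linarith
  have hfnL := hP fn hfn.1
  obtain ⟨A, hA, hPA, hgood⟩ := exists_measurableSet_sampling_event hμ P hP (hn ▸ hn0) hΩ' hpos
    (hf.sub hfnL) hε0 hK0 (ENNReal.ofReal_toReal hKwt).ge (by rwa [hn]) Pr X hXlaw hXindep
  refine ⟨A, hA, hPA, fun s hs e fhat hmin => ?_⟩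
  obtain ⟨h1, h2, h3⟩ := hgood s hs
  have hd := le_ofReal_mul_add_of_sq_le hε0 (hmin.eLpNorm_sub_sq_le hm0 hfn.1 h1 h2 h3)
  have hmeas : ∀ {h : D → ℂ}, MemLp h 2 ϱ → AEStronglyMeasurable h (ϱ.restrict Ω') :=
    fun h => h.aestronglyMeasurable.mono_measure Measure.restrict_le_self
  have htri : ∀ q : ℝ≥0∞, 1 ≤ q → eLpNorm (f - fhat) q (ϱ.restrict Ω')
      ≤ eLpNorm (f - fn) q (ϱ.restrict Ω') + eLpNorm (fhat - fn) q (ϱ.restrict Ω') := fun q hq => by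
    rw [← sub_sub_sub_cancel_right f fhat fn]
    exact eLpNorm_sub_le (hmeas (hf.sub hfnL)) (hmeas ((hP _ hmin.1).sub hfnL)) hq
  constructor
  -- The 9 absorbs the extra `‖f - fn‖` from the triangle inequality: `1 + 8/√ε ≤ 9/√ε` as `√ε ≤ 1`.
  · calc _ ≤ eLpNorm (f - fn) 2 ϱ
          + ENNReal.ofReal (8 / √ε) * (eLpNorm (f - fn) 2 ϱ + ‖e‖ₑ) :=
          (htri 2 (by norm_num)).trans
            (add_le_add (eLpNorm_mono_measure _ Measure.restrict_le_self) hd)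
      _ = (ENNReal.ofReal 1 + ENNReal.ofReal (8 / √ε)) * eLpNorm (f - fn) 2 ϱ
          + ENNReal.ofReal (8 / √ε) * ‖e‖ₑ := by rw [ENNReal.ofReal_one]; ring
      _ ≤ _ := by
          refine add_le_add_left (mul_le_mul_left ?_ _) _
          rw [← ENNReal.ofReal_add zero_le_one (by positivity)]
          refine ENNReal.ofReal_le_ofReal ?_
          have hs0 : 0 < √ε := Real.sqrt_pos.2 hε0
          have hs1 : √ε ≤ 1 := Real.sqrt_le_one.2 hε1.le
          rw [← sub_nonneg]
          have : 9 / √ε - (1 + 8 / √ε) = (1 - √ε) / √ε := by field_simp; ring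
          rw [this]
          exact div_nonneg (by linarith) hs0.le
  · have hsup := eLpNorm_top_le_sqrt_christoffelKappa_mul (ϱ.restrict Ω') P
      (fun p hp => (hP p hp).mono_measure Measure.restrict_le_self) (P.sub_mem hmin.1 hfn.1)
    rw [← hκ] at hsup
    have hconst : κ ^ (1 / 2 : ℝ) * ENNReal.ofReal (8 / √ε)
        = 8 * (κ / ENNReal.ofReal ε) ^ (1 / 2 : ℝ) := by
      rw [ENNReal.div_rpow_of_nonneg _ _ (by norm_num), ENNReal.ofReal_rpow_of_pos hε0,
        ← Real.sqrt_eq_rpow, ENNReal.ofReal_div_of_pos (Real.sqrt_pos.2 hε0)]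
      simp only [div_eq_mul_inv, ENNReal.ofReal_ofNat]
      ring
    calc _ ≤ eLpNorm (f - fn) ∞ (ϱ.restrict Ω') + κ ^ (1 / 2 : ℝ) *
          (ENNReal.ofReal (8 / √ε) * (eLpNorm (f - fn) 2 ϱ + ‖e‖ₑ)) :=
          (htri ∞ le_top).trans (add_le_add_right (hsup.trans (mul_le_mul_right hd _)) _)
      _ = _ := by rw [← mul_assoc, hconst]; ring
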